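/- Let $\eta$ be the metric of a metric space $\mathcal X$ with Borel $\sigma$-algebra $\mathcal F$ and an origin $\mathbf 0\in\mathcal X$, and write $\|\mu-\nu\|=\sup_{A\in\mathcal F}|\mu(A)-\nu(A)|$ for probability measures. Consider the following setup. $P$ is a Markov kernel on $\mathcal X$ that is Harris ergodic with stationary probability distribution $\pi$ (irreducible, Harris recurrent and aperiodic, with $\pi P=\pi$), so that $\lim_{n}\|P^n(x,\cdot)-\pi\|=0$ for all $x\in\mathcal X$; there is $D<\infty$ with $P(x,\{y:\eta(x,y)\le D\})=1$ for all $x$; $K\in\mathcal F$ is bounded and nonempty, $x_0\in K$, and $K_D$ is the set of states within distance $D$ of $K$. An adversarial Markov chain is a process $\{X_n\}_{n\ge 0}$ in $\mathcal X$ with $X_0=x_0$ such that $\mathbf P(X_{n+1}\in A\mid X_0,\dots,X_n)=P(X_n,A)$ whenever $X_n\notin K$ ($n\ge 0$, $A\in\mathcal F$), and such that $X_{n+1}\in K_D$ almost surely whenever $X_n\in K$ (otherwise it may move arbitrarily from $K$). It is bounded in probability if $\lim_{L\to\infty}\sup_{n}\mathbf P(\eta(X_n,\mathbf 0)>L)=0$.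 There exist a countable subset $\mathcal X$ of $\mathbf R^2$ (with the Euclidean metric), an instance of this setup on $\mathcal X$, and an adversarial Markov chain $\{X_n\}$ for it that is not bounded in probability. This is possible even under the strong continuity condition that $\mathcal X$ is closed and $$\forall x\in\mathcal X,\ \forall\epsilon>0,\ \exists\delta>0:\quad \|P(y,\cdot)-P(x,\cdot)\|<\epsilon\ \text{ whenever } \eta(x,y)<\delta .$$ Moreover, under this same condition, the example can be chosen such that $P$ is irreducible and positive recurrent on the countable set $\mathcal X$, while $\{X_n\}$ is a time-homogeneous Markov chain whose transition kernel $Q$ equals $P$ outside $K$, never moves more than a distance $D$, and is irreducible and null recurrent. -/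

import Mathlib

open MeasureTheory ProbabilityTheory Filter Topology
open scoped ENNReal

noncomputable section

namespace AdversarialMarkov

/-! ### Markov chains on a measurable space -/

section Chains

variable {𝓧 : Type*} [MeasurableSpace 𝓧]

/-- Total variation distance `sup_A |μ(A) - ν(A)|` over measurable sets `A`. -/
def tvDist (μ ν : Measure 𝓧) : ℝ :=
  ⨆ A : {A : Set 𝓧 // MeasurableSet A}, |μ.real A.1 - ν.real A.1|

/-- The law on path space of the time-homogeneous Markov chain with transition kernel `κ`
started at `x` (at each time `n` the next state is drawn from `κ` at the current state `h n`). -/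
def chainLaw (κ : Kernel 𝓧 𝓧) [IsMarkovKernel κ] (x : 𝓧) : Measure (ℕ → 𝓧) :=
  Kernel.traj (X := fun _ => 𝓧)
    (fun n => κ.comap (fun h : (i : Finset.Iic n) → 𝓧 => h ⟨n, Finset.mem_Iic.2 le_rfl⟩)
      (measurable_pi_apply _)) 0 (fun _ => x)

/-- `P` is Harris ergodic with stationary probability distribution `ν`: it is irreducible, Harris
recurrent and aperiodic, with invariant probability measure `ν`, and `P ^ n` converges to `ν` in
total variation from every initial state. -/
structure HarrisErgodic (P : Kernel 𝓧 𝓧) [IsMarkovKernel P] (ν : Measure 𝓧) : Prop where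
  prob : IsProbabilityMeasure ν
  invariant : P.Invariant ν
  irreducible : P.IsIrreducible ν
  harris : ∀ A : Set 𝓧, MeasurableSet A → 0 < ν A →
    ∀ x, ∀ᵐ ω ∂(chainLaw P x), ∃ᶠ n in atTop, ω n ∈ A
  aperiodic : ∀ d : ℕ, 2 ≤ d → ¬ ∃ E : ZMod d → Set 𝓧,
    (∀ i, MeasurableSet (E i)) ∧ Pairwise (fun i j => Disjoint (E i) (E j)) ∧
    (∀ i, ∀ x ∈ E i, P x (E (i + 1)) = 1) ∧ 0 < ν (E 0)
  tendsto : ∀ x, Tendsto (fun n : ℕ => tvDist ((P ^ n) x) ν) atTop (𝓝 0)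

/-- The first time `n ≥ 1` at which the path `ω` visits `x` (`∞` if there is none). -/
def returnTime (x : 𝓧) (ω : ℕ → 𝓧) : ℝ≥0∞ :=
  ⨅ (n : ℕ) (_ : 1 ≤ n ∧ ω n = x), (n : ℝ≥0∞)

/-- Every state can be reached from every state (for chains on a countable space). -/
def IsIrreducibleChain (κ : Kernel 𝓧 𝓧) : Prop :=
  ∀ x y, ∃ n : ℕ, 0 < (κ ^ n) x {y}

/-- An irreducible chain on a countable space, all of whose states have finite mean return time. -/
def IsPositiveRecurrent (κ : Kernel 𝓧 𝓧) [IsMarkovKernel κ] : Prop :=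
  IsIrreducibleChain κ ∧ ∀ x, ∫⁻ ω, returnTime x ω ∂(chainLaw κ x) < ∞

/-- An irreducible chain on a countable space, to each of whose states the chain almost surely
returns, with infinite mean return time. -/
def IsNullRecurrent (κ : Kernel 𝓧 𝓧) [IsMarkovKernel κ] : Prop :=
  IsIrreducibleChain κ ∧
    ∀ x, (∀ᵐ ω ∂(chainLaw κ x), returnTime x ω < ∞) ∧
      ∫⁻ ω, returnTime x ω ∂(chainLaw κ x) = ∞

variable {Ω : Type*} [MeasurableSpace Ω]

/-- The σ-algebra generated by `X 0, …, X n`. -/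
abbrev history (X : ℕ → Ω → 𝓧) (n : ℕ) : MeasurableSpace Ω :=
  ⨆ i ∈ Finset.Iic n, MeasurableSpace.comap (X i) inferInstance

/-- `X` is a time-homogeneous Markov chain with transition kernel `κ`:
`ℙ(X (n+1) ∈ A | X 0, …, X n) = κ (X n, A)` almost surely. -/
def IsMarkovChain (κ : Kernel 𝓧 𝓧) (μ : Measure Ω) (X : ℕ → Ω → 𝓧) : Prop :=
  ∀ (n : ℕ) (A : Set 𝓧), MeasurableSet A →
    ∀ᵐ ω ∂μ, (μ⟦X (n + 1) ⁻¹' A | history X n⟧) ω = (κ (X n ω)).real A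

end Chains

/-! ### Adversarial Markov chains on a metric space -/

section Adversarial

variable {𝓧 : Type*} [MetricSpace 𝓧] [MeasurableSpace 𝓧] [BorelSpace 𝓧]

/-- Continuity of `x ↦ P(x, ·)` in total variation. -/
def TVContinuous (P : Kernel 𝓧 𝓧) : Prop :=
  ∀ x, ∀ ε > 0, ∃ δ > 0, ∀ y, dist x y < δ → tvDist (P y) (P x) < ε

/-- `neighbourhood K r` is the set `K_r` of all states within distance `r` of `K`. -/
def neighbourhood (K : Set 𝓧) (r : ℝ) : Set 𝓧 := {y | ∃ x ∈ K, dist x y ≤ r}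

variable (𝓧) in
/-- The ingredients of an adversarial Markov chain: an origin, a Harris ergodic kernel `P` with
jumps bounded by `D`, a bounded nonempty Borel set `K` and an initial state in `K`. -/
structure AdversarialSetup where
  origin : 𝓧
  P : Kernel 𝓧 𝓧
  markov : IsMarkovKernel P
  statDist : Measure 𝓧
  ergodic : HarrisErgodic P statDist
  D : ℝ
  bounded_jumps : ∀ x, P x {y | dist x y ≤ D} = 1
  K : Set 𝓧
  K_measurable : MeasurableSet K
  K_bounded : Bornology.IsBounded K
  K_nonempty : K.Nonempty
  x₀ : 𝓧
  x₀_mem : x₀ ∈ K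

attribute [instance] AdversarialSetup.markov

variable {Ω : Type*} [MeasurableSpace Ω]

/-- `X` is an adversarial process: it starts at `x₀`, follows `P` (given its whole history)
whenever it is outside `K`, and from `K` it may move arbitrarily, but only to points of `K_D`. -/
structure AdversarialSetup.IsAdversarialChain (S : AdversarialSetup 𝓧)
    (μ : Measure Ω) (X : ℕ → Ω → 𝓧) : Prop where
  prob : IsProbabilityMeasure μ
  measurable : ∀ n, Measurable (X n)
  initial : ∀ᵐ ω ∂μ, X 0 ω = S.x₀
  follows : ∀ (n : ℕ) (A : Set 𝓧), MeasurableSet A →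
    ∀ᵐ ω ∂μ, X n ω ∉ S.K →
      (μ⟦X (n + 1) ⁻¹' A | history X n⟧) ω = (S.P (X n ω)).real A
  adversary : ∀ n : ℕ, ∀ᵐ ω ∂μ, X n ω ∈ S.K → X (n + 1) ω ∈ neighbourhood S.K S.D

/-- Boundedness in probability: `lim_{L → ∞} sup_n ℙ(η(X n, 0) > L) = 0`. -/
def AdversarialSetup.BoundedInProbability (S : AdversarialSetup 𝓧)
    (μ : Measure Ω) (X : ℕ → Ω → 𝓧) : Prop :=
  Tendsto (fun L : ℝ => ⨆ n : ℕ, μ {ω | L < dist (X n ω) S.origin}) atTop (𝓝 0)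

end Adversarial

end AdversarialMarkov

end

/-! The state space consists of a base point and of towers a = 0, 1, 2, …, where tower a stands over
the abscissa 1/a; the convention 1/0 = 0 puts tower 0 at the limit of the others. From the cell n of
tower a the chain climbs with probability `climb a n`; otherwise it drops one level and lands in
tower 0, which leads straight down to the base. For fixed n the climbing probability 1/(a+1) tends
to 0 as a grows, so the transition laws converge where the towers accumulate, and the kernel is
continuous in total variation.

From the cell a on, tower a is left only with the tiny probability `decay a`. Getting there has
probability (1/(a+1))^a, but the stay there has mean at least 1/`decay a` = (2(a+1))^a. Thus the
mean time to reach the base from the bottom of tower a lies between 2^a and 2/`decay a`.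

Only the law at the base differs between the two chains, and K is the base alone. The kernel P
enters tower a with probability `decay a` · 2^(-a-2), which makes the mean excursion finite
(`tame_tsum_survival_ne_top`); the base also has positive holding probability, so P is Harris
ergodic (`exists_harrisErgodic`). The adversary enters tower a with probability 2^(-a-1): every
excursion still ends (`wild_tendsto_survival`), but its mean length is infinite
(`wild_tsum_survival_eq_top`).

During one excursion the adversary's chain visits low sites only a bounded mean number of times,
once on the way up and once on the way down each level (`tsum_avoid_low_ne_top`). A renewal argument
(`exists_pow_apply_lt`) then shows that the mass at low sites cannot stay above a positive constant,
so the chain is not bounded in probability.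

The general theory rests on the operator `avoid` of the chain killed at a point: its iterates
applied to 1 are the tails of the hitting time, supersolutions bound its potential, and excursions
of finite mean length yield invariant measures. -/

noncomputable section

namespace AdversarialMarkov

variable {X : Type*} [MeasurableSpace X]

/-! ### Path laws of time-homogeneous chains -/

section Paths

instance chainLaw_isProbabilityMeasure (κ : Kernel X X) [IsMarkovKernel κ] (x : X) :
    IsProbabilityMeasure (chainLaw κ x) := by
  unfold chainLaw; infer_instance

lemma chainLaw_map_zero (κ : Kernel X X) [IsMarkovKernel κ] (x : X) :
    (chainLaw κ x).map (fun ω => ω 0) = Measure.dirac x := by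
  have h : (fun ω : ℕ → X => ω 0) = (fun h : (i : Finset.Iic 0) → X => h ⟨0, by simp⟩) ∘
      (Preorder.frestrictLe (π := fun _ => X) 0) := rfl
  rw [h, ← Measure.map_map (by fun_prop) (by fun_prop), chainLaw,
    Kernel.traj_map_frestrictLe_apply, Kernel.partialTraj_self, Kernel.id_apply,
    Measure.map_dirac' (by fun_prop)]

/-- The Markov property in integrated form. -/
lemma lintegral_chainLaw_succ (κ : Kernel X X) [IsMarkovKernel κ] (x : X) (n : ℕ)
    {F : ((i : Finset.Iic n) → X) → X → ℝ≥0∞} (hF : Measurable (Function.uncurry F)) :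
    ∫⁻ ω, F (Preorder.frestrictLe (π := fun _ => X) n ω) (ω (n + 1)) ∂chainLaw κ x =
      ∫⁻ ω, ∫⁻ y, F (Preorder.frestrictLe (π := fun _ => X) n ω) y ∂κ (ω n) ∂chainLaw κ x := by
  unfold chainLaw
  set T : (n : ℕ) → Kernel ((i : Finset.Iic n) → X) X := fun n =>
    κ.comap (fun h : (i : Finset.Iic n) → X => h ⟨n, Finset.mem_Iic.2 le_rfl⟩)
      (measurable_pi_apply _) with hT
  have h := Kernel.partialTraj_compProd_eq_map_traj (X := fun _ => X) (κ := T) (Nat.zero_le n)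
    (x₀ := fun _ => x)
  have h1 : ∫⁻ ω, F (Preorder.frestrictLe (π := fun _ => X) n ω) (ω (n + 1))
      ∂Kernel.traj (X := fun _ => X) T 0 (fun _ => x) =
      ∫⁻ p, Function.uncurry F p ∂((Kernel.traj (X := fun _ => X) T 0 (fun _ => x)).map
        (fun ω => (Preorder.frestrictLe (π := fun _ => X) n ω, ω (n + 1)))) := by
    rw [lintegral_map hF (by fun_prop)]; rfl
  rw [h1, ← h, Measure.lintegral_compProd hF, ← Kernel.traj_map_frestrictLe_apply,
    lintegral_map hF.lintegral_kernel_prod_right' (by fun_prop)]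
  rfl

lemma lintegral_pow_succ (κ : Kernel X X) (n : ℕ) (x : X) {f : X → ℝ≥0∞} (hf : Measurable f) :
    ∫⁻ z, f z ∂(κ ^ (n + 1)) x = ∫⁻ w, ∫⁻ z, f z ∂κ w ∂(κ ^ n) x := by
  rw [pow_succ']
  exact Kernel.lintegral_comp _ _ _ hf

lemma lintegral_pow_succ' (κ : Kernel X X) (n : ℕ) (x : X) {f : X → ℝ≥0∞} (hf : Measurable f) :
    ∫⁻ z, f z ∂(κ ^ (n + 1)) x = ∫⁻ w, ∫⁻ z, f z ∂(κ ^ n) w ∂κ x := by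
  rw [pow_succ]
  exact Kernel.lintegral_comp _ _ _ hf

lemma pow_zero_apply (κ : Kernel X X) (x : X) : (κ ^ 0) x = Measure.dirac x := by
  rw [pow_zero]; exact Kernel.id_apply x

instance isMarkovKernel_pow (κ : Kernel X X) [IsMarkovKernel κ] (n : ℕ) :
    IsMarkovKernel (κ ^ n) := by
  induction n with
  | zero => rw [pow_zero]; exact inferInstanceAs (IsMarkovKernel Kernel.id)
  | succ n ih => rw [pow_succ]; exact inferInstanceAs (IsMarkovKernel (_ ∘ₖ _))

lemma lintegral_chainLaw_eval (κ : Kernel X X) [IsMarkovKernel κ] (x : X) (n : ℕ)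
    {f : X → ℝ≥0∞} (hf : Measurable f) :
    ∫⁻ ω, f (ω n) ∂chainLaw κ x = ∫⁻ z, f z ∂(κ ^ n) x := by
  induction n generalizing f with
  | zero =>
    rw [pow_zero_apply, ← chainLaw_map_zero κ x, lintegral_map hf (by fun_prop)]
  | succ n ih =>
    have := lintegral_chainLaw_succ κ x n (F := fun _ y => f y) (hf.comp measurable_snd)
    rw [this, ih hf.lintegral_kernel, lintegral_pow_succ κ n x hf]

lemma chainLaw_eval_apply (κ : Kernel X X) [IsMarkovKernel κ] (x : X) (n : ℕ)
    {s : Set X} (hs : MeasurableSet s) :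
    chainLaw κ x {ω | ω n ∈ s} = (κ ^ n) x s := by
  have h := lintegral_chainLaw_eval κ x n (f := s.indicator 1) (measurable_one.indicator hs)
  rw [lintegral_indicator_one hs] at h
  have hm : MeasurableSet {ω : ℕ → X | ω n ∈ s} := hs.preimage (measurable_pi_apply n)
  rw [← h, ← lintegral_indicator_one hm]
  rfl

/-- The coordinate process under `chainLaw κ x` is a Markov chain with transition kernel `κ`. -/
lemma isMarkovChain_chainLaw (κ : Kernel X X) [IsMarkovKernel κ] (x : X) :
    IsMarkovChain κ (chainLaw κ x) (fun n ω => ω n) := by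
  intro n A hA
  have hle : history (fun n (ω : ℕ → X) => ω n) n = Filtration.piLE (X := fun _ => X) n := by
    rw [Filtration.piLE_eq_comap_frestrictLe]
    simp only [history, MeasurableSpace.pi, MeasurableSpace.comap_iSup, MeasurableSpace.comap_comp]
    rw [iSup_subtype']
    rfl
  rw [hle]
  have hm : MeasurableSet ((fun ω : ℕ → X => ω (n + 1)) ⁻¹' A) := hA.preimage (by fun_prop)
  unfold chainLaw
  set T : (n : ℕ) → Kernel ((i : Finset.Iic n) → X) X := fun n =>
    κ.comap (fun h : (i : Finset.Iic n) → X => h ⟨n, Finset.mem_Iic.2 le_rfl⟩)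
      (measurable_pi_apply _) with hT
  have h := Kernel.condExp_traj (X := fun _ => X) (κ := T) (Nat.zero_le n) (x₀ := fun _ => x)
    (f := ((fun ω : ℕ → X => ω (n + 1)) ⁻¹' A).indicator (fun _ => (1 : ℝ)))
    ((integrable_const _).indicator hm)
  filter_upwards [h] with ω hω
  rw [hω, integral_indicator_const _ hm, smul_eq_mul, mul_one, measureReal_def, measureReal_def,
    ← Measure.map_apply (by fun_prop) hA, ← Kernel.map_apply _ (by fun_prop),
    Kernel.map_traj_succ_self]
  rfl

/-- By the Markov property, the probability that the relation fails between times n and n + 1 is an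
average of one-step failure probabilities, all of which vanish. -/
lemma chainLaw_ae_succ (κ : Kernel X X) [IsMarkovKernel κ] (x : X) (n : ℕ) {R : X → X → Prop}
    (hR : MeasurableSet {p : X × X | R p.1 p.2}) (h : ∀ z, ∀ᵐ w ∂κ z, R z w) :
    ∀ᵐ ω ∂chainLaw κ x, R (ω n) (ω (n + 1)) := by
  have h1 := lintegral_chainLaw_succ κ x n
    (F := fun h y => {p : X × X | R p.1 p.2}ᶜ.indicator 1 (h ⟨n, Finset.mem_Iic.2 le_rfl⟩, y))
    ((measurable_one.indicator hR.compl).comp (by fun_prop))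
  have h2 : ∀ z, ∫⁻ y, {p : X × X | R p.1 p.2}ᶜ.indicator (1 : X × X → ℝ≥0∞) (z, y) ∂κ z = 0 := by
    intro z
    refine lintegral_eq_zero_of_ae_eq_zero ?_
    filter_upwards [h z] with w hw
    simp [hw]
  have h3 : ∫⁻ ω, {p : X × X | R p.1 p.2}ᶜ.indicator (1 : X × X → ℝ≥0∞) (ω n, ω (n + 1))
      ∂chainLaw κ x = 0 := by
    refine h1.trans ?_
    simp only [Preorder.frestrictLe_apply, h2, lintegral_zero]
  have hm : Measurable fun ω : ℕ → X =>
      {p : X × X | R p.1 p.2}ᶜ.indicator (1 : X × X → ℝ≥0∞) (ω n, ω (n + 1)) :=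
    (measurable_one.indicator hR.compl).comp
      ((measurable_pi_apply n).prodMk (measurable_pi_apply (n + 1)))
  filter_upwards [(lintegral_eq_zero_iff hm).1 h3] with ω hω
  by_contra hc
  simp [hc] at hω

end Paths

/-! ### Chains killed at a point -/

section Killed

/-- The transition operator of the chain killed on entering `y`. -/
def avoid (κ : Kernel X X) (y : X) (f : X → ℝ≥0∞) (z : X) : ℝ≥0∞ :=
  ∫⁻ w in {y}ᶜ, f w ∂κ z

/-- The probability that the chain started at `z` does not visit `y` at the times `1, …, k`. -/
def survival (κ : Kernel X X) (y : X) (k : ℕ) : X → ℝ≥0∞ :=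
  (avoid κ y)^[k] 1

/-- The paths that do not visit `y` at the times `n + 1, …, n + k`. -/
def missing (y : X) (n k : ℕ) : Set (ℕ → X) :=
  {ω | ∀ i, n < i → i ≤ n + k → ω i ≠ y}

lemma avoid_mono (κ : Kernel X X) (y : X) : Monotone (avoid κ y) :=
  fun _ _ h _ => lintegral_mono h

lemma avoid_le_lintegral (κ : Kernel X X) (y : X) (f : X → ℝ≥0∞) (z : X) :
    avoid κ y f z ≤ ∫⁻ w, f w ∂κ z :=
  setLIntegral_le_lintegral _ _

lemma survival_succ (κ : Kernel X X) (y : X) (k : ℕ) :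
    survival κ y (k + 1) = avoid κ y (survival κ y k) :=
  Function.iterate_succ_apply' _ _ _

lemma survival_zero (κ : Kernel X X) (y z : X) : survival κ y 0 z = 1 := rfl

lemma survival_antitone (κ : Kernel X X) [IsMarkovKernel κ] (y : X) :
    Antitone (survival κ y) := by
  refine antitone_nat_of_succ_le fun k => ?_
  have h : avoid κ y 1 ≤ 1 := fun z => (avoid_le_lintegral κ y 1 z).trans (by simp)
  rw [survival, survival, Function.iterate_succ_apply]
  exact (avoid_mono κ y).iterate k h

lemma survival_le_one (κ : Kernel X X) [IsMarkovKernel κ] (y : X) (k : ℕ) (z : X) :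
    survival κ y k z ≤ 1 :=
  survival_antitone κ y (Nat.zero_le k) z

lemma tendsto_survival_of_iInf_eq_zero (κ : Kernel X X) [IsMarkovKernel κ] (y z : X)
    (h : ⨅ k, survival κ y k z = 0) :
    Tendsto (fun k => survival κ y k z) atTop (𝓝 0) := by
  rw [← h]
  exact tendsto_atTop_iInf fun i j hij => survival_antitone κ y hij z

variable [MeasurableSingletonClass X]

lemma avoid_add_singleton (κ : Kernel X X) (y : X) (f : X → ℝ≥0∞) (z : X) :
    avoid κ y f z + f y * κ z {y} = ∫⁻ w, f w ∂κ z := by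
  rw [avoid, ← lintegral_singleton f y, add_comm]
  exact lintegral_add_compl f (measurableSet_singleton y)

lemma measurableSet_missing (y : X) (n k : ℕ) : MeasurableSet (missing y n k) := by
  have : missing y n k =
      ⋂ i, ⋂ (_ : n < i), ⋂ (_ : i ≤ n + k), (fun ω => ω i) ⁻¹' {y}ᶜ := by ext; simp [missing]
  rw [this]
  exact .iInter fun i => .iInter fun _ => .iInter fun _ =>
    (measurableSet_singleton y).compl.preimage (measurable_pi_apply i)

variable [Countable X]

lemma avoid_iterate_const_mul (κ : Kernel X X) (y : X) (c : ℝ≥0∞) (k : ℕ) (z : X) :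
    (avoid κ y)^[k] (fun _ => c) z = c * survival κ y k z := by
  induction k generalizing z with
  | zero => simp [survival]
  | succ k ih =>
    rw [Function.iterate_succ_apply', survival_succ, avoid, avoid,
      ← lintegral_const_mul _ .of_discrete]
    simp only [ih]

/-- Induction on k by integrating out the last step: the constraint that this step misses y turns
`f` into `avoid κ y f`, and a constraint over one step fewer remains. -/
lemma lintegral_chainLaw_avoid (κ : Kernel X X) [IsMarkovKernel κ] (x y : X) (n k : ℕ)
    (f : X → ℝ≥0∞) :
    ∫⁻ ω, (missing y n k).indicator (fun ω => f (ω (n + k))) ω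
      ∂chainLaw κ x = ∫⁻ z, (avoid κ y)^[k] f z ∂(κ ^ n) x := by
  induction k generalizing f with
  | zero =>
    rw [← lintegral_chainLaw_eval κ x n .of_discrete]
    refine lintegral_congr fun ω => ?_
    rw [Set.indicator_of_mem]
    · simp
    · intro i hi hi'; omega
  | succ k ih =>
    rw [Function.iterate_succ_apply, ← ih (avoid κ y f)]
    have h := lintegral_chainLaw_succ κ x (n + k)
      (F := fun h w => {h : (i : Finset.Iic (n + k)) → X | ∀ i, n < i.1 → h i ≠ y}.indicator
        (fun _ => ({y}ᶜ : Set X).indicator f w) h) ?_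
    · refine Eq.trans (lintegral_congr fun ω => ?_) (h.trans (lintegral_congr fun ω => ?_))
      · by_cases h1 : ω ∈ missing y n (k + 1)
        · rw [Set.indicator_of_mem h1, Set.indicator_of_mem, Set.indicator_of_mem]
          · rfl
          · exact h1 _ (by omega) (by omega)
          · exact fun i hi => h1 i hi (by have := Finset.mem_Iic.1 i.2; omega)
        · rw [Set.indicator_of_notMem h1]
          obtain ⟨i, hi, hi', hy⟩ : ∃ i, n < i ∧ i ≤ n + (k + 1) ∧ ω i = y := by
            by_contra hc
            exact h1 fun i hi hi' hy => hc ⟨i, hi, hi', hy⟩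
          rcases Nat.lt_or_ge i (n + k + 1) with hlt | hge
          · rw [Set.indicator_of_notMem]
            exact fun h => h ⟨i, Finset.mem_Iic.2 (by omega)⟩ hi hy
          · obtain rfl : i = n + k + 1 := by omega
            rw [Set.indicator_of_notMem (s := ({y}ᶜ : Set X)) (fun h => h hy), Set.indicator_zero]
      · by_cases h1 : ω ∈ missing y n k
        · rw [Set.indicator_of_mem h1, avoid,
            ← lintegral_indicator (measurableSet_singleton y).compl]
          refine lintegral_congr fun w => ?_
          rw [Set.indicator_of_mem]
          exact fun i hi => h1 i hi (Finset.mem_Iic.1 i.2)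
        · rw [Set.indicator_of_notMem h1, ← lintegral_zero]
          refine lintegral_congr fun w => ?_
          rw [Set.indicator_of_notMem]
          exact fun h => h1 fun i hi hi' => h ⟨i, Finset.mem_Iic.2 hi'⟩ hi
    · exact Measurable.of_discrete

lemma chainLaw_missing (κ : Kernel X X) [IsMarkovKernel κ] (x y : X) (n k : ℕ) :
    chainLaw κ x (missing y n k) =
      ∫⁻ z, survival κ y k z ∂(κ ^ n) x := by
  have hm := measurableSet_missing y n k
  rw [survival, ← lintegral_chainLaw_avoid κ x y n k 1, ← lintegral_indicator_one hm]
  rfl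

/-- A time T with values in {1, 2, …, ∞} is the sum over k of the indicators of T > k, and `missing
y 0 k` is the event that the return comes after time k. -/
lemma returnTime_eq_tsum {Y : Type*} (y : Y) (ω : ℕ → Y) :
    returnTime y ω =
      ∑' k, (missing y 0 k).indicator 1 ω := by
  classical
  by_cases h : ∃ n, 1 ≤ n ∧ ω n = y
  · have h1 : returnTime y ω = (Nat.find h : ℝ≥0∞) := by
      refine le_antisymm (iInf₂_le (Nat.find h) (Nat.find_spec h)) (le_iInf₂ fun n hn => ?_)
      exact_mod_cast Nat.find_min' h hn
    rw [h1, tsum_eq_sum (s := Finset.range (Nat.find h))]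
    · rw [Finset.sum_congr rfl (g := fun _ => (1 : ℝ≥0∞))]
      · simp
      · intro k hk
        rw [Set.indicator_of_mem]
        · rfl
        · intro i hi hi' hy
          exact Nat.find_min h (m := i) (by have := Finset.mem_range.1 hk; omega) ⟨hi, hy⟩
    · intro k hk
      rw [Set.indicator_of_notMem]
      intro hc
      exact hc _ (Nat.find_spec h).1 (by have := Finset.mem_range.not.1 hk; omega)
        (Nat.find_spec h).2
  · push Not at h
    have h1 : returnTime y ω = ∞ := by
      rw [returnTime, eq_top_iff]
      exact le_iInf₂ fun n hn => absurd hn.2 (h n hn.1)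
    rw [h1, ← ENNReal.tsum_const_eq_top_of_ne_zero (α := ℕ) one_ne_zero]
    refine tsum_congr fun k => ?_
    rw [Set.indicator_of_mem (show ω ∈ missing y 0 k from fun i hi _ => h i hi)]
    rfl

/-- The mean return time is the sum of the tail probabilities. -/
lemma lintegral_returnTime (κ : Kernel X X) [IsMarkovKernel κ] (x y : X) :
    ∫⁻ ω, returnTime y ω ∂chainLaw κ x = ∑' k, survival κ y k x := by
  simp_rw [returnTime_eq_tsum]
  rw [lintegral_tsum fun k =>
    (measurable_one.indicator (measurableSet_missing y 0 k)).aemeasurable]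
  refine tsum_congr fun k => ?_
  rw [lintegral_indicator_one (measurableSet_missing y 0 k), chainLaw_missing, pow_zero_apply,
    lintegral_dirac]

/-- If the survival probabilities tend to zero then `y` is almost surely visited after time `n`. -/
lemma ae_exists_visit (κ : Kernel X X) [IsMarkovKernel κ] (x y : X)
    (h : ∀ z, Tendsto (fun k => survival κ y k z) atTop (𝓝 0)) (n : ℕ) :
    ∀ᵐ ω ∂chainLaw κ x, ∃ i, n < i ∧ ω i = y := by
  have h1 : Tendsto (fun k => ∫⁻ z, survival κ y k z ∂(κ ^ n) x) atTop (𝓝 0) := by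
    rw [← lintegral_zero (μ := (κ ^ n) x)]
    refine tendsto_lintegral_of_dominated_convergence (fun _ => 1) (fun _ => .of_discrete)
      (fun k => .of_forall (survival_le_one κ y k)) (by simp) (.of_forall h)
  rw [ae_iff]
  refine le_antisymm (ge_of_tendsto' h1 fun k => ?_) zero_le
  rw [← chainLaw_missing]
  exact measure_mono fun ω hω i hi _ hy => hω ⟨i, hi, hy⟩

lemma ae_frequently_visit (κ : Kernel X X) [IsMarkovKernel κ] (x y : X)
    (h : ∀ z, Tendsto (fun k => survival κ y k z) atTop (𝓝 0)) :
    ∀ᵐ ω ∂chainLaw κ x, ∃ᶠ n in atTop, ω n = y := by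
  filter_upwards [ae_all_iff.2 (ae_exists_visit κ x y h)] with ω hω
  rw [frequently_atTop]
  intro n
  obtain ⟨i, hi, hy⟩ := hω n
  exact ⟨i, hi.le, hy⟩

lemma ae_returnTime_lt_top (κ : Kernel X X) [IsMarkovKernel κ] (x y : X)
    (h : ∀ z, Tendsto (fun k => survival κ y k z) atTop (𝓝 0)) :
    ∀ᵐ ω ∂chainLaw κ x, returnTime y ω < ∞ := by
  filter_upwards [ae_exists_visit κ x y h 0] with ω ⟨i, hi, hy⟩
  exact (iInf₂_le i ⟨hi, hy⟩).trans_lt (ENNReal.natCast_lt_top i)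

/-- Supersolutions of the Poisson equation of the killed chain bound its potential. -/
lemma tsum_avoid_le (κ : Kernel X X) (y : X) {f V : X → ℝ≥0∞}
    (h : ∀ z, f z + avoid κ y V z ≤ V z) (z : X) :
    ∑' k, (avoid κ y)^[k] f z ≤ V z := by
  refine ENNReal.tsum_le_of_sum_range_le fun n => ?_
  induction n generalizing z with
  | zero => simp
  | succ n ih =>
    rw [Finset.sum_range_succ']
    simp only [Function.iterate_succ_apply', Function.iterate_zero, id]
    rw [add_comm]
    -- After the first term is split off, the remaining partial sum is `avoid` applied to a shorter
    -- one, which the induction hypothesis bounds by `V`.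
    refine le_trans (add_le_add_right ?_ _) (h z)
    simp only [avoid]
    rw [← lintegral_finsetSum _ fun _ _ => .of_discrete]
    exact lintegral_mono ih

/-- The potential of the killed chain solves the Poisson equation. -/
lemma tsum_avoid_eq (κ : Kernel X X) (y : X) (f : X → ℝ≥0∞) (z : X) :
    ∑' k, (avoid κ y)^[k] f z = f z + avoid κ y (fun w => ∑' k, (avoid κ y)^[k] f w) z := by
  rw [tsum_eq_zero_add' ENNReal.summable]
  simp only [Function.iterate_succ_apply', Function.iterate_zero, id]
  rw [avoid, lintegral_tsum fun _ => .of_discrete]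
  rfl

/-- Off y the survival probabilities have a finite sum, so they tend to zero. At y itself `V` may be
infinite; there one step reduces the claim to the other points by dominated convergence. -/
lemma tendsto_survival_of_supersolution (κ : Kernel X X) [IsMarkovKernel κ] (y : X)
    {V : X → ℝ≥0∞} (h : ∀ z, 1 + avoid κ y V z ≤ V z) (hV : ∀ z, z ≠ y → V z ≠ ∞) (z : X) :
    Tendsto (fun k => survival κ y k z) atTop (𝓝 0) := by
  have h1 : ∀ z, z ≠ y → Tendsto (fun k => survival κ y k z) atTop (𝓝 0) := fun z hz =>
    ENNReal.tendsto_atTop_zero_of_tsum_ne_top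
      (ne_top_of_le_ne_top (hV z hz) (tsum_avoid_le κ y (f := 1) h z))
  rw [← tendsto_add_atTop_iff_nat 1]
  simp_rw [survival_succ, avoid]
  rw [← lintegral_zero (μ := (κ z).restrict {y}ᶜ)]
  refine tendsto_lintegral_of_dominated_convergence (fun _ => 1) (fun _ => .of_discrete)
    (fun k => .of_forall (survival_le_one κ y k)) (by simp) ?_
  exact (ae_restrict_iff' (measurableSet_singleton y).compl).2 (.of_forall fun z hz => h1 z hz)

end Killed

/-! ### Invariant probability measures and recurrence -/

section Recurrence

/-- The law at time `k` of the chain started at `y` and killed on its return to `y`. -/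
def taboo (κ : Kernel X X) (y : X) : ℕ → Measure X
  | 0 => Measure.dirac y
  | k + 1 => ((taboo κ y k).bind κ).restrict {y}ᶜ

/-- The occupation measure of an excursion from `y`. -/
def occupation (κ : Kernel X X) (y : X) : Measure X := Measure.sum (taboo κ y)

lemma occupation_singleton_ne_zero (κ : Kernel X X) (y : X) : occupation κ y {y} ≠ 0 := by
  have h : taboo κ y 0 {y} ≤ occupation κ y {y} := Measure.le_sum (taboo κ y) 0 _
  rw [taboo, Measure.dirac_apply_of_mem (Set.mem_singleton y)] at h
  exact (lt_of_lt_of_le one_pos h).ne'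

variable [MeasurableSingletonClass X] [Countable X]

lemma lintegral_invariant {κ : Kernel X X} {ν : Measure X} (h : κ.Invariant ν) (f : X → ℝ≥0∞) :
    ∫⁻ z, ∫⁻ w, f w ∂κ z ∂ν = ∫⁻ z, f z ∂ν := by
  conv_rhs => rw [← h.def]
  rw [Measure.lintegral_bind (κ.measurable.aemeasurable) .of_discrete]

lemma lintegral_avoid_invariant {κ : Kernel X X} {ν : Measure X} (h : κ.Invariant ν)
    (y : X) (f : X → ℝ≥0∞) :
    ∫⁻ z, avoid κ y f z ∂ν + f y * ν {y} = ∫⁻ z, f z ∂ν := by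
  have h1 : ν {y} = ∫⁻ z, κ z {y} ∂ν := by
    conv_lhs => rw [← h.def]
    rw [Measure.bind_apply (measurableSet_singleton y) κ.measurable.aemeasurable]
  rw [h1, ← lintegral_const_mul _ .of_discrete, ← lintegral_add_left .of_discrete,
    ← lintegral_invariant h f]
  simp_rw [avoid_add_singleton]

/-- One half of Kac's formula. -/
lemma tsum_survival_mul_le {κ : Kernel X X} {ν : Measure X} [IsProbabilityMeasure ν]
    (h : κ.Invariant ν) (y : X) :
    (∑' k, survival κ y k y) * ν {y} ≤ 1 := by
  rw [← ENNReal.tsum_mul_right]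
  refine ENNReal.tsum_le_of_sum_range_le fun n => ?_
  -- Under stationarity each killed step loses exactly the mass carried into y, so the lost and the
  -- surviving masses always add up to 1.
  have h1 : ∑ k ∈ Finset.range n, survival κ y k y * ν {y} + ∫⁻ z, survival κ y n z ∂ν = 1 := by
    induction n with
    | zero => simp [survival]
    | succ n ih =>
      rw [Finset.sum_range_succ, add_assoc, add_comm (_ * _), survival_succ,
        lintegral_avoid_invariant h, ih]
  exact h1 ▸ le_self_add

/-- The limit of the survival probabilities is harmonic for the killed chain. -/
lemma avoid_iInf_survival (κ : Kernel X X) [IsMarkovKernel κ] (y : X) :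
    avoid κ y (fun z => ⨅ k, survival κ y k z) = fun z => ⨅ k, survival κ y k z := by
  ext z
  rw [avoid, lintegral_iInf' (fun _ => .of_discrete)
    (.of_forall fun w => fun i j hij => survival_antitone κ y hij w) ?_]
  · refine le_antisymm (le_iInf fun k => ?_) (le_iInf fun k => ?_)
    · refine (iInf_le _ k).trans ?_
      change avoid κ y (survival κ y k) z ≤ _
      rw [← survival_succ]
      exact survival_antitone κ y k.le_succ z
    · refine (iInf_le _ (k + 1)).trans ?_
      rw [survival_succ]
      rfl
  · refine ne_top_of_le_ne_top ENNReal.one_ne_top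
      ((lintegral_mono (survival_le_one κ y 0)).trans ?_)
    simpa using prob_le_one

/-- A point charged by an invariant probability measure is visited almost surely from every point
that can be reached from it. -/
lemma tendsto_survival_of_invariant {κ : Kernel X X} [IsMarkovKernel κ] {ν : Measure X}
    [IsProbabilityMeasure ν] (h : κ.Invariant ν) {y : X} (hy : ν {y} ≠ 0)
    (hr : ∀ z, ∃ n : ℕ, (κ ^ n) y {z} ≠ 0) (z : X) :
    Tendsto (fun k => survival κ y k z) atTop (𝓝 0) := by
  apply tendsto_survival_of_iInf_eq_zero
  set g : X → ℝ≥0∞ := fun z => ⨅ k, survival κ y k z with hg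
  have hA : avoid κ y g = g := avoid_iInf_survival κ y
  have hfin : ∫⁻ z, g z ∂ν ≠ ∞ := by
    refine ne_top_of_le_ne_top ENNReal.one_ne_top ((lintegral_mono fun z => iInf_le _ 0).trans ?_)
    simp [survival_zero]
  -- Integrating the killed-harmonic function `g` against ν leaves the defect `g y * ν {y}`, which
  -- must vanish because the integral is finite.
  have h0 : g y = 0 := by
    have h1 := lintegral_avoid_invariant h y g
    rw [hA] at h1
    have h2 : g y * ν {y} = 0 := by
      have : ∫⁻ z, g z ∂ν + g y * ν {y} = ∫⁻ z, g z ∂ν + 0 := by rw [h1, add_zero]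
      exact (ENNReal.add_right_inj hfin).1 this
    exact (mul_eq_zero.1 h2).resolve_right hy
  -- Since `g` vanishes at y, killing there changes nothing and `g` is harmonic for the full chain;
  -- being nonnegative, it vanishes wherever the chain can go from y.
  have hharm : ∀ w, ∫⁻ z, g z ∂κ w = g w := by
    intro w
    rw [← avoid_add_singleton κ y g w, hA, h0, zero_mul, add_zero]
  have hpow : ∀ n : ℕ, ∫⁻ z, g z ∂(κ ^ n) y = 0 := by
    intro n
    induction n with
    | zero => rw [pow_zero_apply, lintegral_dirac, h0]
    | succ n ih => rw [lintegral_pow_succ κ n y .of_discrete]; simp_rw [hharm, ih]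
  obtain ⟨n, hn⟩ := hr z
  have h3 : ∫⁻ w in {z}, g w ∂(κ ^ n) y = 0 :=
    le_antisymm ((setLIntegral_le_lintegral _ _).trans (hpow n).le) zero_le
  rw [lintegral_singleton] at h3
  exact (mul_eq_zero.1 h3).resolve_right hn

lemma avoid_iterate_le_pow (κ : Kernel X X) (y : X) (f : X → ℝ≥0∞) (n : ℕ) (z : X) :
    (avoid κ y)^[n] f z ≤ ∫⁻ w, f w ∂(κ ^ n) z := by
  induction n generalizing z with
  | zero => rw [pow_zero_apply, lintegral_dirac]; rfl
  | succ n ih =>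
    rw [Function.iterate_succ_apply', lintegral_pow_succ' κ n z .of_discrete]
    exact (avoid_le_lintegral κ y _ z).trans (lintegral_mono ih)

lemma survival_succ_add_pow_le (κ : Kernel X X) [IsMarkovKernel κ] (y : X) (n : ℕ) (z : X) :
    survival κ y (n + 1) z + (κ ^ (n + 1)) z {y} ≤ 1 := by
  have h : survival κ y (n + 1) z ≤ (κ ^ (n + 1)) z {y}ᶜ := by
    rw [survival, Function.iterate_succ_apply]
    refine (avoid_iterate_le_pow κ y _ n z).trans ?_
    rw [← lintegral_indicator_one (measurableSet_singleton y).compl,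
      lintegral_pow_succ κ n z .of_discrete]
    refine lintegral_mono fun w => ?_
    rw [avoid, lintegral_indicator (measurableSet_singleton y).compl]
  refine (add_le_add_left h _).trans ?_
  rw [add_comm, measure_add_measure_compl (measurableSet_singleton y), measure_univ]

/-- Recurrence of one point is inherited by all points of an irreducible chain. -/
lemma tendsto_survival_of_irreducible {κ : Kernel X X} [IsMarkovKernel κ] {o : X}
    (ho : ∀ z, Tendsto (fun k => survival κ o k z) atTop (𝓝 0)) (hirr : IsIrreducibleChain κ)
    (y z : X) : Tendsto (fun k => survival κ y k z) atTop (𝓝 0) := by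
  rcases eq_or_ne o y with rfl | hoy
  · exact ho z
  apply tendsto_survival_of_iInf_eq_zero
  set g : X → ℝ≥0∞ := fun z => ⨅ k, survival κ y k z with hg
  have hA : avoid κ y g = g := avoid_iInf_survival κ y
  have hg1 : ∀ z, g z ≤ 1 := fun z => iInf_le _ 0
  have hmax : ∀ z, g z ≤ g o := by
    intro z
    -- A maximum principle: within n steps the chain from z either has hit o, where the value is `g
    -- o`, or has avoided it, where `g` is at most 1.
    have h1 : ∀ n z, g z ≤ g o + survival κ o n z := by
      intro n
      induction n with
      | zero => intro z; exact (hg1 z).trans (le_add_left le_rfl)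
      | succ n ih =>
        intro z
        calc g z = avoid κ y g z := by rw [hA]
          _ ≤ ∫⁻ w, g w ∂κ z := avoid_le_lintegral κ y g z
          _ = avoid κ o g z + g o * κ z {o} := (avoid_add_singleton κ o g z).symm
          _ ≤ ∫⁻ w in {o}ᶜ, (g o + survival κ o n w) ∂κ z + g o * κ z {o} := by
            gcongr
            exact lintegral_mono ih
          _ = g o * (κ z {o} + κ z {o}ᶜ) + survival κ o (n + 1) z := by
            rw [lintegral_add_left measurable_const, survival_succ, avoid, lintegral_const,
              Measure.restrict_apply_univ]
            ring
          _ = g o + survival κ o (n + 1) z := by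
            rw [measure_add_measure_compl (measurableSet_singleton o), measure_univ, mul_one]
    have h2 : Tendsto (fun n => g o + survival κ o n z) atTop (𝓝 (g o + 0)) :=
      (ho z).const_add _
    rw [add_zero] at h2
    exact ge_of_tendsto' h2 fun n => h1 n z
  obtain ⟨n, hn⟩ := hirr o y
  -- The number of steps is positive since o and y differ.
  obtain ⟨n, rfl⟩ : ∃ m, n = m + 1 := by
    refine Nat.exists_eq_succ_of_ne_zero ?_
    rintro rfl
    rw [pow_zero_apply, Measure.dirac_apply' _ (measurableSet_singleton y)] at hn
    simp [hoy] at hn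
  have hlt : survival κ y (n + 1) o < 1 := by
    have h1 := survival_succ_add_pow_le κ y n o
    refine lt_of_lt_of_le (ENNReal.lt_add_right ?_ hn.ne') h1
    exact ne_top_of_le_ne_top ENNReal.one_ne_top (survival_le_one κ y _ o)
  have hiter : ∀ n, (avoid κ y)^[n] g = g := fun n => Function.iterate_fixed hA n
  -- As `g` is fixed by `avoid` and bounded by its value at o, iterating gives `g o ≤ g o *
  -- survival` with a factor below 1, which forces `g o = 0`.
  have h3 : g o ≤ g o * survival κ y (n + 1) o := by
    rw [← avoid_iterate_const_mul]
    conv_lhs => rw [← hiter (n + 1)]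
    exact (avoid_mono κ y).iterate (n + 1) (fun z => hmax z) o
  have h4 : g o = 0 := by
    by_contra h0
    have hfin : g o ≠ ∞ := ne_top_of_le_ne_top ENNReal.one_ne_top (hg1 o)
    have := ENNReal.mul_lt_mul_right h0 hfin hlt
    rw [mul_one] at this
    exact absurd h3 (not_le.2 this)
  exact le_antisymm ((hmax z).trans h4.le) zero_le

lemma lintegral_taboo (κ : Kernel X X) (y : X) (k : ℕ) (f : X → ℝ≥0∞) :
    ∫⁻ z, f z ∂taboo κ y k = (avoid κ y)^[k] f y := by
  induction k generalizing f with
  | zero => simp [taboo]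
  | succ k ih =>
    rw [Function.iterate_succ_apply, ← ih, taboo,
      ← lintegral_indicator (measurableSet_singleton y).compl,
      Measure.lintegral_bind κ.measurable.aemeasurable .of_discrete]
    refine lintegral_congr fun z => ?_
    rw [lintegral_indicator (measurableSet_singleton y).compl, avoid]

lemma occupation_univ (κ : Kernel X X) (y : X) :
    occupation κ y Set.univ = ∑' k, survival κ y k y := by
  rw [occupation, Measure.sum_apply _ .univ]
  refine tsum_congr fun k => ?_
  rw [survival, ← lintegral_taboo]
  simp

/-- One step of κ, restricted to the complement of y, shifts the time index of the taboo laws by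
one. Only the unit mass at y at time 0 is lost, which explains the `+ 1`. -/
lemma occupation_bind_restrict (κ : Kernel X X) (y : X) :
    (occupation κ y).bind κ {y}ᶜ + 1 = occupation κ y Set.univ ∧
      ∀ z, z ≠ y → (occupation κ y).bind κ {z} = occupation κ y {z} := by
  have hb : ∀ s : Set X, s ⊆ {y}ᶜ →
      (occupation κ y).bind κ s = ∑' k, taboo κ y (k + 1) s := by
    intro s hs
    rw [occupation, Measure.bind_apply (.of_discrete) κ.measurable.aemeasurable,
      lintegral_sum_measure]
    refine tsum_congr fun k => ?_
    rw [taboo, Measure.restrict_apply .of_discrete, Set.inter_eq_left.2 hs,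
      Measure.bind_apply (.of_discrete) κ.measurable.aemeasurable]
  constructor
  · rw [hb _ le_rfl, occupation, Measure.sum_apply _ .univ,
      tsum_eq_zero_add' (f := fun k => taboo κ y k Set.univ) ENNReal.summable, add_comm]
    simp [taboo]
  · intro z hz
    rw [hb _ (by simpa using hz.symm), occupation, Measure.sum_apply _ .of_discrete,
      tsum_eq_zero_add' (f := fun k => taboo κ y k {z}) ENNReal.summable]
    simp [taboo, hz.symm]

/-- The occupation measure of an excursion of finite mean length is invariant. -/
lemma occupation_invariant (κ : Kernel X X) [IsMarkovKernel κ] (y : X)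
    (h : ∑' k, survival κ y k y ≠ ∞) : κ.Invariant (occupation κ y) := by
  obtain ⟨h1, h2⟩ := occupation_bind_restrict κ y
  have hu : (occupation κ y).bind κ Set.univ = occupation κ y Set.univ := by
    rw [Measure.bind_apply .univ κ.measurable.aemeasurable]
    simp
  have hfin : occupation κ y Set.univ ≠ ∞ := by rwa [occupation_univ]
  have hy : occupation κ y {y} = 1 := by
    rw [occupation, Measure.sum_apply _ .of_discrete, tsum_eq_zero_add' ENNReal.summable]
    simp [taboo]
  -- The step preserves the total mass, and the complement of y carries that mass minus 1;
  -- finiteness permits cancellation.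
  have hyb : (occupation κ y).bind κ {y} = 1 := by
    have h3 := measure_add_measure_compl (μ := (occupation κ y).bind κ) (measurableSet_singleton y)
    rw [hu, ← h1, add_comm] at h3
    refine (ENNReal.add_right_inj ?_).1 h3
    exact ne_top_of_le_ne_top hfin (h1 ▸ le_self_add)
  refine Measure.ext_of_singleton fun z => ?_
  rcases eq_or_ne z y with rfl | hz
  · rw [hy, hyb]
  · exact h2 z hz

/-- A chain with an excursion of finite mean length has an invariant probability measure. -/
lemma exists_invariant (κ : Kernel X X) [IsMarkovKernel κ] (y : X)
    (h : ∑' k, survival κ y k y ≠ ∞) :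
    ∃ ν : Measure X, IsProbabilityMeasure ν ∧ κ.Invariant ν ∧ ν {y} ≠ 0 := by
  have hfin : occupation κ y Set.univ ≠ ∞ := by rwa [occupation_univ]
  have h0 : occupation κ y Set.univ ≠ 0 := fun hc =>
    occupation_singleton_ne_zero κ y (measure_mono_null (Set.subset_univ _) hc)
  refine ⟨(occupation κ y Set.univ)⁻¹ • occupation κ y, ⟨?_⟩, ?_, ?_⟩
  · simp [ENNReal.inv_mul_cancel h0 hfin]
  · rw [Kernel.Invariant, Measure.bind_smul, (occupation_invariant κ y h).def]
  · simp [hfin, occupation_singleton_ne_zero]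

lemma invariant_pow_apply {κ : Kernel X X} {ν : Measure X} (h : κ.Invariant ν) (n : ℕ)
    (s : Set X) : ∫⁻ z, (κ ^ n) z s ∂ν = ν s := by
  induction n with
  | zero =>
    simp_rw [pow_zero_apply]
    rw [← lintegral_indicator_one (μ := ν) .of_discrete]
    refine lintegral_congr fun z => ?_
    rw [Measure.dirac_apply]
  | succ n ih =>
    rw [← ih, ← lintegral_invariant h fun z => (κ ^ n) z s]
    refine lintegral_congr fun z => ?_
    have := lintegral_pow_succ' κ n z (f := s.indicator 1) .of_discrete
    simpa [lintegral_indicator_one (MeasurableSet.of_discrete (s := s))] using this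

/-- An invariant probability measure of an irreducible chain charges every point. -/
lemma invariant_singleton_ne_zero {κ : Kernel X X} {ν : Measure X} [IsProbabilityMeasure ν]
    (h : κ.Invariant ν) (hirr : IsIrreducibleChain κ) (y : X) : ν {y} ≠ 0 := by
  intro hy
  obtain ⟨x, hx⟩ : ∃ x, ν {x} ≠ 0 := by
    by_contra! hc
    have := measure_iUnion_null hc
    rw [Set.iUnion_of_singleton, measure_univ] at this
    exact one_ne_zero this
  obtain ⟨n, hn⟩ := hirr x y
  have h1 := invariant_pow_apply h n {y}
  rw [hy] at h1
  have h2 : ∫⁻ w in {x}, (κ ^ n) w {y} ∂ν = 0 :=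
    le_antisymm ((setLIntegral_le_lintegral _ _).trans h1.le) zero_le
  rw [lintegral_singleton] at h2
  exact (mul_ne_zero hn.ne' hx) h2

/-- Positive recurrence follows from the finiteness of one mean return time. -/
lemma tsum_survival_ne_top_of_irreducible {κ : Kernel X X} [IsMarkovKernel κ]
    (hirr : IsIrreducibleChain κ) {x : X} (h : ∑' k, survival κ x k x ≠ ∞) (y : X) :
    ∑' k, survival κ y k y ≠ ∞ := by
  obtain ⟨ν, hν, hinv, -⟩ := exists_invariant κ x h
  intro hc
  have h1 := tsum_survival_mul_le hinv y
  rw [hc, ENNReal.top_mul (invariant_singleton_ne_zero hinv hirr y)] at h1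
  simp at h1

end Recurrence

/-! ### Convergence to equilibrium -/

section Ergodic

lemma parallelComp_pow (κ : Kernel X X) [IsMarkovKernel κ] (n : ℕ) :
    (κ ∥ₖ κ) ^ n = (κ ^ n) ∥ₖ (κ ^ n) := by
  induction n with
  | zero => rw [pow_zero, pow_zero]; exact Kernel.id_parallelComp_id.symm
  | succ n ih =>
    rw [pow_succ, pow_succ, ih]
    exact Kernel.parallelComp_comp_parallelComp

lemma tvDist_nonneg (μ ν : Measure X) : 0 ≤ tvDist μ ν :=
  Real.iSup_nonneg fun _ => abs_nonneg _

lemma tvDist_le {μ ν : Measure X} [IsProbabilityMeasure μ] [IsProbabilityMeasure ν] {c : ℝ≥0∞}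
    (hc : c ≠ ∞) (h : ∀ s, MeasurableSet s → μ s ≤ ν s + c)
    (h' : ∀ s, MeasurableSet s → ν s ≤ μ s + c) : tvDist μ ν ≤ c.toReal := by
  have : Nonempty {A : Set X // MeasurableSet A} := ⟨⟨∅, .empty⟩⟩
  refine ciSup_le fun A => ?_
  have h1 := ENNReal.toReal_mono (ENNReal.add_ne_top.2 ⟨measure_ne_top ν A, hc⟩) (h A.1 A.2)
  have h2 := ENNReal.toReal_mono (ENNReal.add_ne_top.2 ⟨measure_ne_top μ A, hc⟩) (h' A.1 A.2)
  rw [ENNReal.toReal_add (measure_ne_top _ _) hc] at h1 h2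
  rw [abs_le]
  constructor <;> simp only [measureReal_def] <;> linarith

variable [MeasurableSingletonClass X]

lemma pow_mul_pow_le (κ : Kernel X X) (m n : ℕ) (x y z : X) :
    (κ ^ m) x {y} * (κ ^ n) y {z} ≤ (κ ^ (m + n)) x {z} := by
  have h : (κ ^ (m + n)) x {z} = ∫⁻ w, (κ ^ n) w {z} ∂(κ ^ m) x := by
    rw [add_comm, pow_add]
    exact Kernel.comp_apply' _ _ _ (measurableSet_singleton z)
  rw [h, mul_comm, ← lintegral_singleton (fun w => (κ ^ n) w {z}) y]
  exact setLIntegral_le_lintegral _ _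

lemma pow_ne_zero_trans {κ : Kernel X X} {m n : ℕ} {x y z : X} (h : (κ ^ m) x {y} ≠ 0)
    (h' : (κ ^ n) y {z} ≠ 0) : (κ ^ (m + n)) x {z} ≠ 0 := fun hc =>
  mul_ne_zero h h' (le_antisymm ((pow_mul_pow_le κ m n x y z).trans hc.le) zero_le)

lemma pow_self_ne_zero {κ : Kernel X X} {o : X} (ho : κ o {o} ≠ 0) (n : ℕ) :
    (κ ^ n) o {o} ≠ 0 := by
  induction n with
  | zero => rw [pow_zero_apply]; simp
  | succ n ih => exact pow_ne_zero_trans ih (by rwa [pow_one])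

/-- Waiting at o lengthens any path from o. This lets two independent copies be brought to
prescribed states at a common time. -/
lemma exists_forall_pow_ne_zero {κ : Kernel X X} (hirr : IsIrreducibleChain κ) {o : X}
    (ho : κ o {o} ≠ 0) (z : X) : ∃ N, ∀ n, N ≤ n → (κ ^ n) o {z} ≠ 0 := by
  obtain ⟨N, hN⟩ := hirr o z
  refine ⟨N, fun n hn => ?_⟩
  obtain ⟨m, rfl⟩ := Nat.exists_eq_add_of_le' hn
  exact pow_ne_zero_trans (pow_self_ne_zero ho m) hN.ne'

variable [Countable X]

lemma parallelComp_invariant {κ : Kernel X X} [IsMarkovKernel κ] {ν : Measure X}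
    [IsProbabilityMeasure ν] (h : κ.Invariant ν) : (κ ∥ₖ κ).Invariant (ν.prod ν) := by
  have h1 : ∀ y, ν {y} = ∫⁻ z, κ z {y} ∂ν := by
    intro y
    conv_lhs => rw [← h.def]
    rw [Measure.bind_apply (measurableSet_singleton y) κ.measurable.aemeasurable]
  refine Measure.ext_of_singleton fun ⟨a, b⟩ => ?_
  rw [Measure.bind_apply (measurableSet_singleton _) (Kernel.measurable _).aemeasurable]
  have h2 : ∀ p : X × X, (κ ∥ₖ κ) p {(a, b)} = κ p.1 {a} * κ p.2 {b} := by
    intro p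
    rw [← Set.singleton_prod_singleton, Kernel.parallelComp_apply_prod]
  simp_rw [h2]
  rw [lintegral_prod_mul (f := fun z => κ z {a}) (g := fun z => κ z {b})
    .of_discrete .of_discrete, ← h1, ← h1,
    ← Set.singleton_prod_singleton, Measure.prod_prod]

/-- Two independent copies of the chain can be coupled from their first joint visit to `o` on. -/
lemma pow_apply_le_add_survival (κ : Kernel X X) [IsMarkovKernel κ] (o : X) (s : Set X) (n : ℕ)
    (x y : X) : (κ ^ n) x s ≤ (κ ^ n) y s + survival (κ ∥ₖ κ) (o, o) n (x, y) := by
  induction n generalizing x y with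
  | zero =>
    rw [survival_zero]
    exact prob_le_one.trans (le_add_left le_rfl)
  | succ n ih =>
    have hs : ∀ x, (κ ^ (n + 1)) x s = ∫⁻ w, (κ ^ n) w s ∂κ x := by
      intro x
      rw [pow_succ]
      exact Kernel.comp_apply' _ _ _ .of_discrete
    have h1 : ∀ f : X → ℝ≥0∞, ∫⁻ w, f w ∂κ x = ∫⁻ p, f p.1 ∂(κ ∥ₖ κ) (x, y) := by
      intro f
      rw [Kernel.lintegral_parallelComp _ .of_discrete]
      simp
    have h2 : ∀ f : X → ℝ≥0∞, ∫⁻ w, f w ∂κ y = ∫⁻ p, f p.2 ∂(κ ∥ₖ κ) (x, y) := by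
      intro f
      rw [Kernel.lintegral_parallelComp _ .of_discrete]
      simp
    rw [hs, hs, h1, h2, survival_succ, avoid,
      ← lintegral_indicator (measurableSet_singleton (o, o)).compl,
      ← lintegral_add_left .of_discrete]
    refine lintegral_mono fun p => ?_
    -- From (o, o) both copies have the same law, so no error term is needed; from any other pair
    -- the induction hypothesis supplies the killed term.
    by_cases hp : p = (o, o)
    · subst hp
      exact le_self_add
    · rw [Set.indicator_of_mem (by simpa using hp)]
      exact ih p.1 p.2

/-- The convergence theorem for irreducible chains with an invariant probability measure and a
point of positive holding probability. -/
lemma tendsto_tvDist_pow {κ : Kernel X X} [IsMarkovKernel κ] (hirr : IsIrreducibleChain κ)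
    {ν : Measure X} [IsProbabilityMeasure ν] (h : κ.Invariant ν) {o : X} (ho : κ o {o} ≠ 0)
    (x : X) : Tendsto (fun n : ℕ => tvDist ((κ ^ n) x) ν) atTop (𝓝 0) := by
  have hsurv : ∀ p, Tendsto (fun k => survival (κ ∥ₖ κ) (o, o) k p) atTop (𝓝 0) := by
    refine tendsto_survival_of_invariant (parallelComp_invariant h) ?_ ?_
    · rw [← Set.singleton_prod_singleton, Measure.prod_prod]
      exact mul_ne_zero (invariant_singleton_ne_zero h hirr o)
        (invariant_singleton_ne_zero h hirr o)
    · rintro ⟨a, b⟩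
      obtain ⟨N, hN⟩ := exists_forall_pow_ne_zero hirr ho a
      obtain ⟨M, hM⟩ := exists_forall_pow_ne_zero hirr ho b
      refine ⟨N + M, ?_⟩
      rw [parallelComp_pow, ← Set.singleton_prod_singleton, Kernel.parallelComp_apply_prod]
      exact mul_ne_zero (hN _ (by omega)) (hM _ (by omega))
  -- Total variation needs inequalities in both directions; the two orders of the pair provide one
  -- each. Averaging over y with law ν replaces the second chain by equilibrium.
  set c : ℕ → ℝ≥0∞ := fun n =>
    ∫⁻ y, (survival (κ ∥ₖ κ) (o, o) n (x, y) + survival (κ ∥ₖ κ) (o, o) n (y, x)) ∂ν with hcdef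
  have hle : ∀ n, c n ≤ 2 := by
    intro n
    calc c n ≤ ∫⁻ _, (1 + 1) ∂ν := lintegral_mono fun y =>
          add_le_add (survival_le_one _ _ _ _) (survival_le_one _ _ _ _)
      _ = 2 := by simp [one_add_one_eq_two]
  have hc : Tendsto c atTop (𝓝 0) := by
    rw [← lintegral_zero (μ := ν)]
    refine tendsto_lintegral_of_dominated_convergence (fun _ => 1 + 1) (fun _ => .of_discrete)
      (fun k => .of_forall fun y => add_le_add (survival_le_one _ _ _ _) (survival_le_one _ _ _ _))
      (by simp) (.of_forall fun y => ?_)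
    simpa using (hsurv (x, y)).add (hsurv (y, x))
  have hfin : ∀ n, c n ≠ ∞ := fun n => ne_top_of_le_ne_top (by simp) (hle n)
  refine squeeze_zero (fun n => tvDist_nonneg _ _) (fun n => tvDist_le (hfin n) ?_ ?_)
    ((ENNReal.tendsto_toReal ENNReal.zero_ne_top).comp hc)
  · intro s _
    rw [← invariant_pow_apply h n s, hcdef, ← lintegral_add_left .of_discrete]
    calc (κ ^ n) x s = ∫⁻ _, (κ ^ n) x s ∂ν := by simp
      _ ≤ _ := lintegral_mono fun y => (pow_apply_le_add_survival κ o s n x y).trans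
          (by gcongr; exact le_self_add)
  · intro s _
    rw [← invariant_pow_apply h n s]
    calc ∫⁻ y, (κ ^ n) y s ∂ν ≤ ∫⁻ y, ((κ ^ n) x s + (survival (κ ∥ₖ κ) (o, o) n (x, y) +
          survival (κ ∥ₖ κ) (o, o) n (y, x))) ∂ν := lintegral_mono fun y =>
          (pow_apply_le_add_survival κ o s n y x).trans (by gcongr; exact le_add_self)
      _ = _ := by rw [lintegral_add_left measurable_const, lintegral_const, measure_univ, mul_one]

/-- An irreducible chain with a point of positive holding probability and finite mean return time
is Harris ergodic. -/
lemma exists_harrisErgodic {κ : Kernel X X} [IsMarkovKernel κ] (hirr : IsIrreducibleChain κ)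
    {o : X} (ho : κ o {o} ≠ 0) (hfin : ∑' k, survival κ o k o ≠ ∞) :
    ∃ ν : Measure X, HarrisErgodic κ ν := by
  obtain ⟨ν, hν, hinv, -⟩ := exists_invariant κ o hfin
  refine ⟨ν, hν, hinv, ⟨?_⟩, ?_, ?_, fun x => tendsto_tvDist_pow hirr hinv ho x⟩
  · intro A _ hA x
    obtain ⟨y, hy⟩ := nonempty_of_measure_ne_zero hA.ne'
    obtain ⟨n, hn⟩ := hirr x y
    exact ⟨n, hn.trans_le (measure_mono (Set.singleton_subset_iff.2 hy))⟩
  · intro A _ hA x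
    obtain ⟨y, hy⟩ := nonempty_of_measure_ne_zero hA.ne'
    have hs := tendsto_survival_of_invariant hinv (invariant_singleton_ne_zero hinv hirr y)
      fun z => (hirr y z).imp fun _ => ne_of_gt
    filter_upwards [ae_frequently_visit κ x y hs] with ω hω
    exact hω.mono fun n hn => hn ▸ hy
  · rintro d hd ⟨E, -, hdisj, hstep, h0⟩
    obtain ⟨x, hx⟩ := nonempty_of_measure_ne_zero h0.ne'
    -- The chain started in class 0 is in class n at time n. If it reaches o, then o lies in class
    -- n, and the holding probability puts o in class n + 1 as well.
    have hpow : ∀ n : ℕ, (κ ^ n) x (E n)ᶜ = 0 := by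
      intro n
      induction n with
      | zero => rw [pow_zero_apply, Measure.dirac_apply]; simpa using hx
      | succ n ih =>
        have h1 : (κ ^ (n + 1)) x (E ((n + 1 : ℕ) : ZMod d))ᶜ =
            ∫⁻ w, κ w (E ((n + 1 : ℕ) : ZMod d))ᶜ ∂(κ ^ n) x := by
          rw [pow_succ']
          exact Kernel.comp_apply' _ _ _ .of_discrete
        rw [h1]
        refine lintegral_eq_zero_of_ae_eq_zero ?_
        filter_upwards [(ae_iff.2 ih : ∀ᵐ w ∂(κ ^ n) x, w ∈ E n)] with w hw
        have h2 := hstep n w hw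
        rw [Nat.cast_succ]
        exact (prob_compl_eq_zero_iff .of_discrete).2 h2
    obtain ⟨n, hn⟩ := hirr x o
    have hoE : o ∈ E n := by
      by_contra hc
      exact hn.ne' (measure_mono_null (Set.singleton_subset_iff.2 hc) (hpow n))
    have hoE' : o ∈ E (n + 1) := by
      by_contra hc
      exact ho (measure_mono_null (Set.singleton_subset_iff.2 hc)
        ((prob_compl_eq_zero_iff .of_discrete).2 (hstep n o hoE)))
    have : Fact (1 < d) := ⟨hd⟩
    exact Set.disjoint_left.1 (hdisj (by simp : (n : ZMod d) ≠ n + 1)) hoE hoE'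

end Ergodic

/-! ### Escape from sets of finite occupation -/

section Renewal

variable [MeasurableSingletonClass X] [Countable X]

/-- Decomposition of the law at time `n` at the last visit to the starting point. -/
lemma lintegral_pow_eq_sum_antidiagonal (κ : Kernel X X) (o : X) (n : ℕ) (f : X → ℝ≥0∞) :
    ∫⁻ z, f z ∂(κ ^ n) o =
      ∑ p ∈ Finset.HasAntidiagonal.antidiagonal n, (κ ^ p.1) o {o} * (avoid κ o)^[p.2] f o := by
  induction n generalizing f with
  | zero =>
    have h := pow_zero_apply κ o
    rw [pow_zero] at h
    simp [h]
  | succ n ih =>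
    -- The added step either misses o, giving one more factor `avoid`, or lands in o, giving the new
    -- term whose last visit is at time n + 1.
    rw [lintegral_pow_succ κ n o .of_discrete, Finset.Nat.sum_antidiagonal_succ']
    simp_rw [← avoid_add_singleton κ o f]
    rw [lintegral_add_left .of_discrete, ih, add_comm, lintegral_const_mul _ .of_discrete]
    simp only [Function.iterate_succ_apply, Function.iterate_zero, id]
    congr 1
    rw [mul_comm]
    congr 1
    rw [pow_succ']
    exact (Kernel.comp_apply' _ _ _ (measurableSet_singleton o)).symm

lemma sum_range_sum_antidiagonal {M : Type*} [AddCommMonoid M] (f : ℕ × ℕ → M) (N : ℕ) :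
    ∑ n ∈ Finset.range N, ∑ p ∈ Finset.HasAntidiagonal.antidiagonal n, f p =
      ∑ p ∈ (Finset.range N).biUnion Finset.HasAntidiagonal.antidiagonal, f p := by
  refine (Finset.sum_biUnion fun m _ n _ hmn => Finset.disjoint_left.2 fun p hp hp' => hmn ?_).symm
  rw [Finset.HasAntidiagonal.mem_antidiagonal] at hp hp'
  omega

/-- The triangle i + j < N lies in the square i, j < N; the next lemma uses that this square lies in
the triangle i + j < 2N. -/
lemma sum_antidiagonal_le_mul (u b : ℕ → ℝ≥0∞) (N : ℕ) :
    ∑ n ∈ Finset.range N, ∑ p ∈ Finset.HasAntidiagonal.antidiagonal n, u p.1 * b p.2 ≤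
      (∑ n ∈ Finset.range N, u n) * ∑ n ∈ Finset.range N, b n := by
  rw [sum_range_sum_antidiagonal, Finset.sum_mul_sum, ← Finset.sum_product']
  refine Finset.sum_le_sum_of_subset fun p hp => ?_
  simp only [Finset.mem_biUnion, Finset.mem_range, Finset.HasAntidiagonal.mem_antidiagonal] at hp
  obtain ⟨n, hn, hp⟩ := hp
  simp only [Finset.mem_product, Finset.mem_range]
  omega

lemma mul_le_sum_antidiagonal (u b : ℕ → ℝ≥0∞) (N : ℕ) :
    (∑ n ∈ Finset.range N, u n) * ∑ n ∈ Finset.range N, b n ≤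
      ∑ n ∈ Finset.range (2 * N), ∑ p ∈ Finset.HasAntidiagonal.antidiagonal n,
        u p.1 * b p.2 := by
  rw [sum_range_sum_antidiagonal, Finset.sum_mul_sum, ← Finset.sum_product']
  refine Finset.sum_le_sum_of_subset fun p hp => ?_
  simp only [Finset.mem_product, Finset.mem_range] at hp
  simp only [Finset.mem_biUnion, Finset.mem_range, Finset.HasAntidiagonal.mem_antidiagonal]
  exact ⟨p.1 + p.2, by omega, rfl⟩

/-- A chain with infinite mean return time to `o` cannot keep a fixed positive fraction of its mass
in a set on which an excursion from `o` spends only finite mean time. -/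
lemma exists_pow_apply_lt {κ : Kernel X X} [IsMarkovKernel κ] {o : X}
    (hinf : ∑' k, survival κ o k o = ∞) {s : Set X}
    (hs : ∑' k, (avoid κ o)^[k] (s.indicator 1) o ≠ ∞) {c : ℝ≥0∞} (hc : c ≠ 0) :
    ∃ n : ℕ, (κ ^ n) o s < c := by
  by_contra! hcon
  set C := ∑' k, (avoid κ o)^[k] (s.indicator 1) o with hC
  have hctop : c ≠ ∞ := ne_top_of_le_ne_top ENNReal.one_ne_top ((hcon 0).trans prob_le_one)
  -- With U the mean number of visits to o before time N and G the truncated mean return time, N c ≤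
  -- U C and U G ≤ 2N combine to N G c ≤ 2 N C.
  have hbound : ∀ N : ℕ, ∑ k ∈ Finset.range N, survival κ o k o ≤ C * 2 / c := by
    intro N
    rcases Nat.eq_zero_or_pos N with rfl | hN
    · simp
    set U := ∑ n ∈ Finset.range N, (κ ^ n) o {o} with hU
    set G := ∑ k ∈ Finset.range N, survival κ o k o with hG
    have h1 : N * c ≤ U * C := by
      calc (N : ℝ≥0∞) * c = ∑ n ∈ Finset.range N, c := by simp
        _ ≤ ∑ n ∈ Finset.range N, (κ ^ n) o s := Finset.sum_le_sum fun n _ => hcon n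
        _ = ∑ n ∈ Finset.range N, ∑ p ∈ Finset.HasAntidiagonal.antidiagonal n,
            (κ ^ p.1) o {o} * (avoid κ o)^[p.2] (s.indicator 1) o := by
          refine Finset.sum_congr rfl fun n _ => ?_
          rw [← lintegral_pow_eq_sum_antidiagonal, lintegral_indicator_one .of_discrete]
        _ ≤ U * ∑ k ∈ Finset.range N, (avoid κ o)^[k] (s.indicator 1) o :=
          sum_antidiagonal_le_mul (fun n => (κ ^ n) o {o}) _ N
        _ ≤ U * C := by gcongr; exact ENNReal.sum_le_tsum _
    -- Each antidiagonal sum is the decomposition of total mass 1 at the last visit to o.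
    have h2 : U * G ≤ 2 * N := by
      calc U * G ≤ ∑ n ∈ Finset.range (2 * N), ∑ p ∈ Finset.HasAntidiagonal.antidiagonal n,
            (κ ^ p.1) o {o} * survival κ o p.2 o :=
          mul_le_sum_antidiagonal (fun n => (κ ^ n) o {o}) (fun k => survival κ o k o) N
        _ = ∑ n ∈ Finset.range (2 * N), 1 := by
          refine Finset.sum_congr rfl fun n _ => ?_
          simp only [survival]
          rw [← lintegral_pow_eq_sum_antidiagonal]
          simp
        _ = 2 * N := by simp
    rw [ENNReal.le_div_iff_mul_le (.inl hc) (.inl hctop)]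
    have hN0 : (N : ℝ≥0∞) ≠ 0 := by exact_mod_cast hN.ne'
    refine (ENNReal.mul_le_mul_iff_right hN0 (ENNReal.natCast_ne_top N)).1 ?_
    calc (N : ℝ≥0∞) * (G * c) = N * c * G := by ring
      _ ≤ U * C * G := by gcongr
      _ = C * (U * G) := by ring
      _ ≤ C * (2 * N) := by gcongr
      _ = N * (C * 2) := by ring
  have := ENNReal.tsum_le_of_sum_range_le hbound
  rw [hinf, top_le_iff] at this
  exact ENNReal.div_ne_top (ENNReal.mul_ne_top hs (by simp)) hc this

end Renewal

/-! ### The tower chains -/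

section Towers

/-- The rate at which the tower `a` is left above the height `a`. -/
def decay (a : ℕ) : ℝ := (1 / (a + 1) / 2) ^ a

/-- The probability of climbing from the height `n` in the tower `a`. The towers become hard to
climb from any given height as `a` grows, and the tower `0` only leads down. -/
def climb (a n : ℕ) : ℝ := if n < a then 1 / (a + 1) else 1 - decay a

lemma decay_pos (a : ℕ) : 0 < decay a := by unfold decay; positivity

lemma decay_le_quarter {a : ℕ} (ha : a ≠ 0) : decay a ≤ 1 / 4 := by
  have h1 : (1 : ℝ) ≤ a := by exact_mod_cast Nat.one_le_iff_ne_zero.2 ha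
  have h2 : (1 : ℝ) / (a + 1) ≤ 1 / 2 := one_div_le_one_div_of_le (by norm_num) (by linarith)
  have h0 : (0 : ℝ) ≤ 1 / (a + 1) / 2 := by positivity
  calc decay a ≤ (1 / (a + 1) / 2) ^ 1 :=
        pow_le_pow_of_le_one h0 (by linarith) (Nat.one_le_iff_ne_zero.2 ha)
    _ ≤ 1 / 4 := by rw [pow_one]; linarith

lemma decay_zero : decay 0 = 1 := by simp [decay]

lemma decay_le_one (a : ℕ) : decay a ≤ 1 := by
  rcases eq_or_ne a 0 with rfl | ha
  · exact decay_zero.le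
  · exact (decay_le_quarter ha).trans (by norm_num)

lemma climb_zero (n : ℕ) : climb 0 n = 0 := by simp [climb, decay_zero]

lemma climb_nonneg (a n : ℕ) : 0 ≤ climb a n := by
  unfold climb
  split_ifs
  · positivity
  · linarith [decay_le_one a]

lemma climb_pos {a : ℕ} (ha : a ≠ 0) (n : ℕ) : 0 < climb a n := by
  unfold climb
  split_ifs
  · positivity
  · linarith [decay_le_quarter ha]

lemma climb_le (a n : ℕ) : climb a n ≤ 1 - decay a := by
  unfold climb
  split_ifs with h
  · have h1 : (1 : ℝ) ≤ a := by exact_mod_cast (by omega : 1 ≤ a)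
    have h2 : (1 : ℝ) / (a + 1) ≤ 1 / 2 := one_div_le_one_div_of_le (by norm_num) (by linarith)
    linarith [decay_le_quarter (by omega : a ≠ 0)]
  · exact le_rfl

lemma climb_lt_one (a n : ℕ) : climb a n < 1 := by
  linarith [climb_le a n, decay_pos a]

lemma tendsto_climb (n : ℕ) : Tendsto (fun a => climb a n) atTop (𝓝 0) := by
  refine (tendsto_one_div_add_atTop_nhds_zero_nat (𝕜 := ℝ)).congr' ?_
  filter_upwards [eventually_gt_atTop n] with a ha
  rw [climb, if_pos ha]

/-- The states: a base point and the cells of the towers. -/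
inductive Site
  | base : Site
  | cell (a n : ℕ) : Site

open Site

instance : MeasurableSpace Site := ⊤

instance : DiscreteMeasurableSpace Site := ⟨fun _ => trivial⟩

/-- The site below a cell at the height `n`, always in the tower `0`. -/
def below : ℕ → Site
  | 0 => base
  | n + 1 => cell 0 n

/-- The transition probabilities, depending on the law `ρ` with which the base is left. -/
def move (ρ : Measure Site) : Site → Measure Site
  | base => ρ
  | cell a n => ENNReal.ofReal (climb a n) • Measure.dirac (cell a (n + 1)) +
      ENNReal.ofReal (1 - climb a n) • Measure.dirac (below n)

/-- The measure with mass `w a` at the bottom of the tower `a` and the remaining mass at the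
base. -/
def launch (w : ℕ → ℝ≥0∞) : Measure Site :=
  Measure.sum (fun a => w a • Measure.dirac (cell a 0)) + (1 - ∑' a, w a) • Measure.dirac base

lemma lintegral_launch (w : ℕ → ℝ≥0∞) (f : Site → ℝ≥0∞) :
    ∫⁻ s, f s ∂launch w = ∑' a, w a * f (cell a 0) + (1 - ∑' a, w a) * f base := by
  simp [launch, lintegral_add_measure, lintegral_sum_measure]

lemma isProbabilityMeasure_launch {w : ℕ → ℝ≥0∞} (hw : ∑' a, w a ≤ 1) :
    IsProbabilityMeasure (launch w) := by
  constructor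
  rw [← lintegral_one, lintegral_launch]
  simp [add_tsub_cancel_of_le hw]

lemma ofReal_climb_add (a n : ℕ) :
    ENNReal.ofReal (climb a n) + ENNReal.ofReal (1 - climb a n) = 1 := by
  rw [← ENNReal.ofReal_add (climb_nonneg a n) (by linarith [climb_lt_one a n])]
  simp

/-! ### The embedding in the plane -/

/-- The horizontal coordinate of a site; the towers accumulate at the tower `0`. -/
def abscissa : Site → ℝ
  | base => 0
  | cell a _ => 1 / a

/-- The vertical coordinate of a site. -/
def ordinate : Site → ℝ
  | base => 0
  | cell _ n => n + 1

/-- The position of a site in the plane. -/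
def position (s : Site) : EuclideanSpace ℝ (Fin 2) := !₂[abscissa s, ordinate s]

lemma position_injective : Function.Injective position := by
  intro s t h
  have h0 : abscissa s = abscissa t := by simpa [position] using congrArg (fun v => v 0) h
  have h1 : ordinate s = ordinate t := by simpa [position] using congrArg (fun v => v 1) h
  rcases s with _ | ⟨a, n⟩ <;> rcases t with _ | ⟨b, m⟩ <;> simp only [abscissa, ordinate] at h0 h1
  · rfl
  · linarith [(Nat.cast_nonneg m : (0 : ℝ) ≤ m)]
  · linarith [(Nat.cast_nonneg n : (0 : ℝ) ≤ n)]
  · have h2 : (a : ℝ) = b := by simpa using h0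
    have h3 : (n : ℝ) = m := by linarith
    rw [Nat.cast_injective h2, Nat.cast_injective h3]

/-- The state space in the plane. -/
def towers : Set (EuclideanSpace ℝ (Fin 2)) := Set.range position

instance : Countable Site := by
  refine Function.Injective.countable (β := Option (ℕ × ℕ))
    (f := fun s => match s with
      | base => none
      | cell a n => some (a, n)) ?_
  rintro (_ | ⟨a, n⟩) (_ | ⟨b, m⟩) h <;> simp_all

lemma countable_towers : towers.Countable := Set.countable_range _

instance : Countable towers := countable_towers

lemma isClosed_towers : IsClosed towers := by
  have h1 : IsClosed (Set.range fun a : ℕ => (1 : ℝ) / a) := by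
    have h := (tendsto_one_div_atTop_nhds_zero_nat (𝕜 := ℝ)).isCompact_insert_range.isClosed
    -- The limit point 0 already belongs to the range as the abscissa of tower 0.
    have h0 : (0 : ℝ) ∈ Set.range fun a : ℕ => (1 : ℝ) / a := ⟨0, by simp⟩
    rwa [Set.insert_eq_of_mem h0] at h
  have h2 : IsClosed (Set.range fun n : ℕ => (n : ℝ) + 1) := by
    have h := Nat.isClosedEmbedding_coe_real.isClosedMap _
      (isClosed_discrete (Set.range Nat.succ))
    rw [← Set.range_comp] at h
    convert h using 2
    ext n
    simp
  have h3 : towers = {position base} ∪ ((fun v => v 0) ⁻¹' (Set.range fun a : ℕ => (1 : ℝ) / a) ∩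
      (fun v => v 1) ⁻¹' (Set.range fun n : ℕ => (n : ℝ) + 1)) := by
    ext v
    constructor
    · rintro ⟨s, rfl⟩
      rcases s with _ | ⟨a, n⟩
      · exact .inl rfl
      · exact .inr ⟨⟨a, by simp [position, abscissa]⟩, ⟨n, by simp [position, ordinate]⟩⟩
    · rintro (hv | ⟨⟨a, ha⟩, ⟨n, hn⟩⟩)
      · exact ⟨base, hv.symm⟩
      · refine ⟨cell a n, ?_⟩
        ext i
        fin_cases i
        · simpa [position, abscissa] using ha
        · simpa [position, ordinate] using hn
  rw [h3]
  exact isClosed_singleton.union ((h1.preimage (by fun_prop)).inter (h2.preimage (by fun_prop)))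

/-- The parametrization of the state space by sites. -/
def site : Site ≃ towers := Equiv.ofInjective position position_injective

lemma dist_site_sq (s t : Site) : dist (site s) (site t) ^ 2 =
    (abscissa s - abscissa t) ^ 2 + (ordinate s - ordinate t) ^ 2 := by
  have h : dist (site s) (site t) = dist (position s) (position t) := rfl
  rw [h, EuclideanSpace.dist_eq, Real.sq_sqrt (by positivity)]
  simp [Fin.sum_univ_two, position, Real.dist_eq, sq_abs]

lemma abs_abscissa_sub_le (s t : Site) : |abscissa s - abscissa t| ≤ dist (site s) (site t) := by
  refine abs_le_of_sq_le_sq ?_ dist_nonneg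
  rw [dist_site_sq]
  linarith [sq_nonneg (ordinate s - ordinate t)]

lemma abs_ordinate_sub_le (s t : Site) : |ordinate s - ordinate t| ≤ dist (site s) (site t) := by
  refine abs_le_of_sq_le_sq ?_ dist_nonneg
  rw [dist_site_sq]
  linarith [sq_nonneg (abscissa s - abscissa t)]

lemma dist_site_le_two {s t : Site} (h : |abscissa s - abscissa t| ≤ 1)
    (h' : |ordinate s - ordinate t| ≤ 1) : dist (site s) (site t) ≤ 2 := by
  refine (sq_le_sq₀ dist_nonneg (by norm_num)).1 ?_
  rw [dist_site_sq, ← sq_abs, ← sq_abs (ordinate s - ordinate t)]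
  nlinarith [abs_nonneg (abscissa s - abscissa t), abs_nonneg (ordinate s - ordinate t)]

/-- The chain on the state space with base law `ρ`. -/
def walk (ρ : Measure Site) : Kernel towers towers where
  toFun x := (move ρ (site.symm x)).map site
  measurable' := .of_discrete

lemma lintegral_walk (ρ : Measure Site) (s : Site) (f : towers → ℝ≥0∞) :
    ∫⁻ y, f y ∂walk ρ (site s) = ∫⁻ t, f (site t) ∂move ρ s := by
  change ∫⁻ y, f y ∂(move ρ (site.symm (site s))).map site = _
  rw [lintegral_map .of_discrete .of_discrete, Equiv.symm_apply_apply]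

lemma lintegral_walk_base (ρ : Measure Site) (f : towers → ℝ≥0∞) :
    ∫⁻ y, f y ∂walk ρ (site base) = ∫⁻ t, f (site t) ∂ρ :=
  lintegral_walk ρ base f

lemma lintegral_walk_cell (ρ : Measure Site) (a n : ℕ) (f : towers → ℝ≥0∞) :
    ∫⁻ y, f y ∂walk ρ (site (cell a n)) = ENNReal.ofReal (climb a n) * f (site (cell a (n + 1))) +
      ENNReal.ofReal (1 - climb a n) * f (site (below n)) := by
  rw [lintegral_walk]
  simp [move, lintegral_add_measure]

lemma walk_base_apply (ρ : Measure Site) (A : Set towers) :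
    walk ρ (site base) A = ∫⁻ t, A.indicator 1 (site t) ∂ρ := by
  rw [← lintegral_walk_base, lintegral_indicator_one .of_discrete]

lemma walk_cell_apply (ρ : Measure Site) (a n : ℕ) (A : Set towers) :
    walk ρ (site (cell a n)) A =
      ENNReal.ofReal (climb a n) * A.indicator 1 (site (cell a (n + 1))) +
      ENNReal.ofReal (1 - climb a n) * A.indicator 1 (site (below n)) := by
  rw [← lintegral_walk_cell, lintegral_indicator_one .of_discrete]

instance walk_isMarkovKernel (ρ : Measure Site) [IsProbabilityMeasure ρ] :
    IsMarkovKernel (walk ρ) := by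
  refine ⟨fun x => ⟨?_⟩⟩
  obtain ⟨s, rfl⟩ := site.surjective x
  rcases s with _ | ⟨a, n⟩
  · rw [walk_base_apply]; simp
  · rw [walk_cell_apply]; simp [ofReal_climb_add]

lemma walk_eq_of_ne_base (ρ ρ' : Measure Site) {x : towers} (hx : x ≠ site base) :
    walk ρ x = walk ρ' x := by
  obtain ⟨s, rfl⟩ := site.surjective x
  rcases s with _ | ⟨a, n⟩
  · exact absurd rfl hx
  · ext A _
    rw [walk_cell_apply, walk_cell_apply]

lemma abscissa_mem (s : Site) : 0 ≤ abscissa s ∧ abscissa s ≤ 1 := by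
  rcases s with _ | ⟨a, n⟩
  · simp [abscissa]
  · refine ⟨by simp [abscissa], ?_⟩
    rcases Nat.eq_zero_or_pos a with rfl | ha
    · simp [abscissa]
    · exact (div_le_one (by positivity)).2 (by exact_mod_cast ha)

lemma abs_abscissa_sub_le_one (s t : Site) : |abscissa s - abscissa t| ≤ 1 := by
  obtain ⟨h1, h2⟩ := abscissa_mem s
  obtain ⟨h3, h4⟩ := abscissa_mem t
  rw [abs_le]
  constructor <;> linarith

lemma ordinate_below (n : ℕ) : ordinate (below n) = n := by
  cases n <;> simp [below, ordinate]

/-- The chains never move by more than a distance `2`. -/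
lemma walk_dist_le (w : ℕ → ℝ≥0∞) (hw : ∑' a, w a ≤ 1) (x : towers) :
    walk (launch w) x {y | dist x y ≤ 2} = 1 := by
  obtain ⟨s, rfl⟩ := site.surjective x
  rcases s with _ | ⟨a, n⟩
  · have h0 : site base ∈ {y | dist (site base) y ≤ 2} := by simp
    have h1 : ∀ a, site (cell a 0) ∈ {y | dist (site base) y ≤ 2} := fun a =>
      dist_site_le_two (abs_abscissa_sub_le_one _ _) (by simp [ordinate])
    rw [walk_base_apply, lintegral_launch]
    simp only [Set.indicator_of_mem h0, Set.indicator_of_mem (h1 _)]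
    simp [add_tsub_cancel_of_le hw]
  · have h0 : site (below n) ∈ {y | dist (site (cell a n)) y ≤ 2} :=
      dist_site_le_two (abs_abscissa_sub_le_one _ _) (by rw [ordinate_below]; simp [ordinate])
    have h1 : site (cell a (n + 1)) ∈ {y | dist (site (cell a n)) y ≤ 2} :=
      dist_site_le_two (abs_abscissa_sub_le_one _ _) (by simp [ordinate])
    rw [walk_cell_apply, Set.indicator_of_mem h0, Set.indicator_of_mem h1]
    simp [ofReal_climb_add]

/-! ### Continuity in total variation -/

lemma eq_of_abs_ordinate_sub_lt {s t : Site} (h : |ordinate s - ordinate t| < 1) :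
    (s = base ∧ t = base) ∨ ∃ a b n, s = cell a n ∧ t = cell b n := by
  rw [abs_lt] at h
  rcases s with _ | ⟨a, n⟩ <;> rcases t with _ | ⟨b, m⟩ <;> simp only [ordinate] at h
  · exact .inl ⟨rfl, rfl⟩
  · linarith [(Nat.cast_nonneg m : (0 : ℝ) ≤ m)]
  · linarith [(Nat.cast_nonneg n : (0 : ℝ) ≤ n)]
  · have h1 : (n : ℝ) < m + 1 := by linarith
    have h2 : (m : ℝ) < n + 1 := by linarith
    norm_cast at h1 h2
    obtain rfl : n = m := by omega
    exact .inr ⟨a, b, n, rfl, rfl⟩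

/-- Tower 0 moves to `below n` with certainty, and tower b does so unless it climbs. -/
lemma tvDist_walk_cell_le (ρ : Measure Site) [IsProbabilityMeasure ρ] (b n : ℕ) :
    tvDist (walk ρ (site (cell b n))) (walk ρ (site (cell 0 n))) ≤ climb b n := by
  have h0 : ∀ A, walk ρ (site (cell 0 n)) A = A.indicator 1 (site (below n)) := by
    intro A
    rw [walk_cell_apply, climb_zero]
    simp
  have h1 : ∀ (A : Set towers) y, A.indicator (1 : towers → ℝ≥0∞) y ≤ 1 := fun A y =>
    Set.indicator_le_self' (by simp) y
  rw [← ENNReal.toReal_ofReal (climb_nonneg b n)]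
  refine tvDist_le ENNReal.ofReal_ne_top (fun A _ => ?_) (fun A _ => ?_)
  · rw [h0, walk_cell_apply, add_comm]
    refine add_le_add (mul_le_of_le_one_left zero_le ?_) (mul_le_of_le_one_right zero_le (h1 A _))
    exact ENNReal.ofReal_le_one.2 (by linarith [climb_nonneg b n])
  · rw [h0, walk_cell_apply]
    calc A.indicator 1 (site (below n))
        = ENNReal.ofReal (climb b n) * A.indicator 1 (site (below n)) +
          ENNReal.ofReal (1 - climb b n) * A.indicator 1 (site (below n)) := by
          rw [← add_mul, ofReal_climb_add, one_mul]
      _ ≤ ENNReal.ofReal (climb b n) +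
          ENNReal.ofReal (1 - climb b n) * A.indicator 1 (site (below n)) := by
          gcongr
          exact mul_le_of_le_one_right zero_le (h1 A _)
      _ ≤ _ := by rw [add_comm]; gcongr; exact le_add_self

lemma tvDist_self {X : Type*} [MeasurableSpace X] (μ : Measure X) : tvDist μ μ = 0 := by
  simp [tvDist]

lemma eq_of_abs_one_div_sub_lt {a b : ℕ} (ha : a ≠ 0)
    (h : |(1 : ℝ) / a - 1 / b| < 1 / (a * (a + 1))) : b = a := by
  have ha' : (0 : ℝ) < a := by positivity
  have h1 : (1 : ℝ) / (a * (a + 1)) = 1 / a - 1 / (a + 1) := by field_simp; ring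
  rw [h1, abs_lt] at h
  have h2 : (0 : ℝ) < 1 / (a + 1) := by positivity
  rcases Nat.eq_zero_or_pos b with rfl | hb
  · simp only [Nat.cast_zero, div_zero, sub_zero] at h
    linarith [h.2]
  have hb' : (0 : ℝ) < b := by positivity
  have h3 : b < a + 1 := by
    have : (1 : ℝ) / (a + 1) < 1 / b := by linarith [h.2]
    have := (one_div_lt_one_div (by positivity) hb').1 this
    exact_mod_cast this
  by_contra hne
  have h4 : (b : ℝ) + 1 ≤ a := by exact_mod_cast (by omega : b + 1 ≤ a)
  have h5 : (1 : ℝ) / a - 1 / (a + 1) ≤ 1 / b - 1 / a := by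
    rw [div_sub_div _ _ ha'.ne' (by positivity), div_sub_div _ _ hb'.ne' ha'.ne',
      div_le_div_iff₀ (by positivity) (by positivity)]
    have h6 : (b : ℝ) * a ≤ a * (a + 1) := by nlinarith
    nlinarith [mul_nonneg (sub_nonneg.2 h4) (by positivity : (0 : ℝ) ≤ a * (a + 1))]
  linarith [h.1]

lemma walk_tvContinuous (ρ : Measure Site) [IsProbabilityMeasure ρ] : TVContinuous (walk ρ) := by
  intro x ε hε
  obtain ⟨s, rfl⟩ := site.surjective x
  rcases s with _ | ⟨a, n⟩
  · refine ⟨1, one_pos, fun y hy => ?_⟩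
    obtain ⟨t, rfl⟩ := site.surjective y
    rcases eq_of_abs_ordinate_sub_lt ((abs_ordinate_sub_le _ _).trans_lt hy) with
      ⟨-, rfl⟩ | ⟨_, _, _, h, -⟩
    · rwa [tvDist_self]
    · cases h
  rcases eq_or_ne a 0 with rfl | ha
  · obtain ⟨N, hN⟩ := eventually_atTop.1 ((tendsto_climb n).eventually_lt_const hε)
    -- Distance below 1 forces equal heights, and 1/b < 1/(N+1) forces b > N + 1, where climbing is
    -- already unlikely.
    refine ⟨1 / (N + 1), by positivity, fun y hy => ?_⟩
    obtain ⟨t, rfl⟩ := site.surjective y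
    have hle : (1 : ℝ) / (N + 1) ≤ 1 :=
      (div_le_one (by positivity)).2 (by linarith [(Nat.cast_nonneg N : (0 : ℝ) ≤ N)])
    rcases eq_of_abs_ordinate_sub_lt (((abs_ordinate_sub_le _ _).trans_lt hy).trans_le hle) with
      ⟨h, -⟩ | ⟨a', b, m, h, rfl⟩
    · cases h
    obtain ⟨rfl, rfl⟩ := Site.cell.inj h
    rcases Nat.eq_zero_or_pos b with rfl | hb
    · rwa [tvDist_self]
    refine (tvDist_walk_cell_le ρ b n).trans_lt (hN b ?_)
    have h1 := (abs_abscissa_sub_le _ _).trans_lt hy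
    simp only [abscissa, Nat.cast_zero, div_zero, zero_sub, abs_neg] at h1
    rw [abs_of_pos (by positivity), one_div_lt_one_div (by positivity) (by positivity)] at h1
    exact (by exact_mod_cast h1 : N + 1 < b).le.trans' (Nat.le_succ N)
  · refine ⟨1 / (a * (a + 1)), by positivity, fun y hy => ?_⟩
    obtain ⟨t, rfl⟩ := site.surjective y
    have h1 : (1 : ℝ) ≤ a := by exact_mod_cast Nat.one_le_iff_ne_zero.2 ha
    have hle : (1 : ℝ) / (a * (a + 1)) ≤ 1 := (div_le_one (by positivity)).2 (by nlinarith)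
    rcases eq_of_abs_ordinate_sub_lt (((abs_ordinate_sub_le _ _).trans_lt hy).trans_le hle) with
      ⟨h, -⟩ | ⟨a', b, m, h, rfl⟩
    · cases h
    obtain ⟨rfl, rfl⟩ := Site.cell.inj h
    obtain rfl := eq_of_abs_one_div_sub_lt ha ((abs_abscissa_sub_le _ _).trans_lt hy)
    rwa [tvDist_self]

end Towers

section TowerEstimates

open Site

/-! ### Recurrence properties of the tower chains -/

lemma exists_pow_ne_zero_trans {X : Type*} [MeasurableSpace X] [MeasurableSingletonClass X]
    {κ : Kernel X X} {x y z : X} (h : ∃ n : ℕ, (κ ^ n) x {y} ≠ 0)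
    (h' : ∃ n : ℕ, (κ ^ n) y {z} ≠ 0) : ∃ n : ℕ, (κ ^ n) x {z} ≠ 0 := by
  obtain ⟨m, hm⟩ := h
  obtain ⟨n, hn⟩ := h'
  exact ⟨m + n, pow_ne_zero_trans hm hn⟩

lemma walk_cell_succ_ne_zero (ρ : Measure Site) {a : ℕ} (ha : a ≠ 0) (n : ℕ) :
    walk ρ (site (cell a n)) {site (cell a (n + 1))} ≠ 0 := by
  rw [walk_cell_apply, Set.indicator_of_mem (Set.mem_singleton _)]
  simp [climb_pos ha n]

lemma walk_cell_below_ne_zero (ρ : Measure Site) (a n : ℕ) :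
    walk ρ (site (cell a n)) {site (below n)} ≠ 0 := by
  rw [walk_cell_apply, Set.indicator_of_mem (Set.mem_singleton (site (below n)))]
  simp [climb_lt_one a n]

lemma walk_isIrreducibleChain {w : ℕ → ℝ≥0∞} (hw : ∀ a, w a ≠ 0) :
    IsIrreducibleChain (walk (launch w)) := by
  set κ := walk (launch w) with hκ
  have hstep : ∀ {x y : towers}, κ x {y} ≠ 0 → ∃ n : ℕ, (κ ^ n) x {y} ≠ 0 := fun h =>
    ⟨1, by rwa [pow_one]⟩
  have hbelow : ∀ n, ∃ k : ℕ, (κ ^ k) (site (below n)) {site base} ≠ 0 := by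
    intro n
    induction n with
    | zero => exact ⟨0, by rw [pow_zero_apply]; simp [below]⟩
    | succ n ih => exact exists_pow_ne_zero_trans (hstep (walk_cell_below_ne_zero _ 0 n)) ih
  have hto : ∀ x, ∃ k : ℕ, (κ ^ k) x {site base} ≠ 0 := by
    intro x
    obtain ⟨s, rfl⟩ := site.surjective x
    rcases s with _ | ⟨a, n⟩
    · exact hbelow 0
    · exact exists_pow_ne_zero_trans (hstep (walk_cell_below_ne_zero _ a n)) (hbelow n)
  have hlaunch : ∀ a, κ (site base) {site (cell a 0)} ≠ 0 := by
    intro a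
    rw [hκ, walk_base_apply, lintegral_launch]
    intro hc
    have h1 := (add_eq_zero.1 hc).1
    rw [ENNReal.tsum_eq_zero] at h1
    have h2 := h1 a
    rw [Set.indicator_of_mem (Set.mem_singleton _)] at h2
    simp [hw a] at h2
  have hclimb : ∀ a n, a ≠ 0 → ∃ k : ℕ, (κ ^ k) (site base) {site (cell a n)} ≠ 0 := by
    intro a n ha
    induction n with
    | zero => exact hstep (hlaunch a)
    | succ n ih => exact exists_pow_ne_zero_trans ih (hstep (walk_cell_succ_ne_zero _ ha n))
  have hfrom : ∀ x, ∃ k : ℕ, (κ ^ k) (site base) {x} ≠ 0 := by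
    intro x
    obtain ⟨s, rfl⟩ := site.surjective x
    rcases s with _ | ⟨a, n⟩
    · exact hbelow 0
    rcases eq_or_ne a 0 with rfl | ha
    -- Tower 0 cannot be climbed; its cell n is entered by dropping from cell n + 1 of tower 1.
    · exact exists_pow_ne_zero_trans (hclimb 1 (n + 1) one_ne_zero)
        (hstep (walk_cell_below_ne_zero _ 1 (n + 1)))
    · exact hclimb a n ha
  intro x y
  obtain ⟨k, hk⟩ := exists_pow_ne_zero_trans (hto x) (hfrom y)
  exact ⟨k, pos_iff_ne_zero.2 hk⟩

lemma avoid_walk_launch (w : ℕ → ℝ≥0∞) (f : towers → ℝ≥0∞) :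
    avoid (walk (launch w)) (site base) f (site base) = ∑' a, w a * f (site (cell a 0)) := by
  rw [avoid, ← lintegral_indicator (measurableSet_singleton _).compl, lintegral_walk_base,
    lintegral_launch]
  simp [site.injective.eq_iff]

lemma avoid_walk_cell_zero (ρ : Measure Site) (a : ℕ) (f : towers → ℝ≥0∞) :
    avoid (walk ρ) (site base) f (site (cell a 0)) =
      ENNReal.ofReal (climb a 0) * f (site (cell a 1)) := by
  rw [avoid, ← lintegral_indicator (measurableSet_singleton _).compl, lintegral_walk_cell]
  simp [site.injective.eq_iff, below]

lemma avoid_walk_cell_succ (ρ : Measure Site) (a n : ℕ) (f : towers → ℝ≥0∞) :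
    avoid (walk ρ) (site base) f (site (cell a (n + 1))) =
      ENNReal.ofReal (climb a (n + 1)) * f (site (cell a (n + 2))) +
        ENNReal.ofReal (1 - climb a (n + 1)) * f (site (cell 0 n)) := by
  rw [avoid, ← lintegral_indicator (measurableSet_singleton _).compl, lintegral_walk_cell]
  simp [site.injective.eq_iff, below]

/-- A bound for the mean time to reach the base. -/
def meanBound (c : ℝ≥0∞) : Site → ℝ≥0∞
  | base => c
  | cell a n => ENNReal.ofReal (n + 2 / decay a)

/-- A drop lands in tower 0, where the extra term 2/`decay` is only 2. A climb has probability at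
most 1 − `decay a`, so the expected extra term from tower a decreases by enough to pay for the unit
of time and the gained height. -/
lemma meanBound_cell (ρ : Measure Site) (c : ℝ≥0∞) (a n : ℕ) :
    1 + avoid (walk ρ) (site base) (fun x => meanBound c (site.symm x)) (site (cell a n)) ≤
      meanBound c (cell a n) := by
  have hd := decay_pos a
  have hc := climb_le a n
  have hc0 := climb_nonneg a n
  have hc1 := climb_lt_one a n
  have key : climb a n * (2 / decay a) ≤ 2 / decay a - 2 := by
    calc climb a n * (2 / decay a) ≤ (1 - decay a) * (2 / decay a) := by gcongr
      _ = 2 / decay a - 2 := by field_simp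
  cases n with
  | zero =>
    rw [avoid_walk_cell_zero]
    simp only [Equiv.symm_apply_apply, meanBound]
    rw [← ENNReal.ofReal_one, ← ENNReal.ofReal_mul hc0,
      ← ENNReal.ofReal_add zero_le_one (by positivity)]
    refine ENNReal.ofReal_le_ofReal ?_
    push_cast
    nlinarith
  | succ n =>
    rw [avoid_walk_cell_succ]
    simp only [Equiv.symm_apply_apply, meanBound, decay_zero]
    rw [← ENNReal.ofReal_one, ← ENNReal.ofReal_mul hc0, ← ENNReal.ofReal_mul (by linarith),
      ← ENNReal.ofReal_add (by positivity) (mul_nonneg (by linarith) (by positivity)),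
      ← ENNReal.ofReal_add zero_le_one
        (add_nonneg (by positivity) (mul_nonneg (by linarith) (by positivity)))]
    refine ENNReal.ofReal_le_ofReal ?_
    push_cast
    nlinarith

/-- The climbing weights of the ergodic chain. -/
def tameWeight (a : ℕ) : ℝ≥0∞ := ENNReal.ofReal (decay a) * 2⁻¹ * 2⁻¹ ^ (a + 1)

/-- The climbing weights of the adversary. -/
def wildWeight (a : ℕ) : ℝ≥0∞ := 2⁻¹ ^ (a + 1)

lemma tsum_wildWeight : ∑' a, wildWeight a = 1 := by
  unfold wildWeight
  rw [ENNReal.tsum_geometric_add_one, ENNReal.one_sub_inv_two, inv_inv]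
  exact ENNReal.inv_mul_cancel (by simp) (by simp)

lemma tsum_tameWeight_le : ∑' a, tameWeight a ≤ 2⁻¹ := by
  calc ∑' a, tameWeight a ≤ ∑' a, 2⁻¹ * wildWeight a := ENNReal.tsum_le_tsum fun a => by
        unfold tameWeight wildWeight
        gcongr
        exact mul_le_of_le_one_left zero_le (ENNReal.ofReal_le_one.2 (decay_le_one a))
    _ = 2⁻¹ := by rw [ENNReal.tsum_mul_left, tsum_wildWeight, mul_one]

lemma tameWeight_ne_zero (a : ℕ) : tameWeight a ≠ 0 := by
  simp [tameWeight, decay_pos a]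

lemma wildWeight_ne_zero (a : ℕ) : wildWeight a ≠ 0 := by
  simp [wildWeight]

instance : IsProbabilityMeasure (launch tameWeight) :=
  isProbabilityMeasure_launch (tsum_tameWeight_le.trans (by simp))

instance : IsProbabilityMeasure (launch wildWeight) :=
  isProbabilityMeasure_launch tsum_wildWeight.le

lemma walk_tame_holding : walk (launch tameWeight) (site base) {site base} ≠ 0 := by
  rw [walk_base_apply, lintegral_launch, Set.indicator_of_mem (Set.mem_singleton _)]
  intro hc
  have h1 := (add_eq_zero.1 hc).2
  simp only [Pi.one_apply, mul_one, tsub_eq_zero_iff_le] at h1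
  exact absurd (h1.trans tsum_tameWeight_le) (by simp)

lemma tame_tsum_survival_ne_top :
    ∑' k, survival (walk (launch tameWeight)) (site base) k (site base) ≠ ∞ := by
  -- The value 2 at the base is the unit of time plus the launched bounds, and `tameWeight a` ·
  -- 2/`decay a` = `wildWeight a` has sum 1.
  refine ne_top_of_le_ne_top (b := meanBound 2 (site.symm (site base))) ?_
    (tsum_avoid_le _ (site base) (f := 1) (V := fun x => meanBound 2 (site.symm x)) ?_ _)
  · simp [meanBound]
  · intro z
    obtain ⟨s, rfl⟩ := site.surjective z
    rcases s with _ | ⟨a, n⟩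
    · rw [avoid_walk_launch]
      simp only [Equiv.symm_apply_apply, meanBound]
      have h1 : ∀ a, tameWeight a * ENNReal.ofReal ((0 : ℕ) + 2 / decay a) = wildWeight a := by
        intro a
        have h2 : ENNReal.ofReal (decay a) * ENNReal.ofReal ((0 : ℕ) + 2 / decay a) = 2 := by
          rw [← ENNReal.ofReal_mul (decay_pos a).le]
          have : decay a * ((0 : ℕ) + 2 / decay a) = 2 := by
            have := (decay_pos a).ne'
            push_cast
            field_simp
            ring
          rw [this]
          simp
        calc tameWeight a * ENNReal.ofReal ((0 : ℕ) + 2 / decay a)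
            = (ENNReal.ofReal (decay a) * ENNReal.ofReal ((0 : ℕ) + 2 / decay a)) * 2⁻¹ *
              2⁻¹ ^ (a + 1) := by unfold tameWeight; ring
          _ = wildWeight a := by
            rw [h2, ENNReal.mul_inv_cancel (by simp) (by simp), one_mul, wildWeight]
      simp only [h1, tsum_wildWeight, Pi.one_apply]
      exact one_add_one_eq_two.le
    · rw [Equiv.symm_apply_apply]
      exact meanBound_cell _ 2 a n

/-! ### Null recurrence of the adversary's chain -/

lemma wild_tendsto_survival (z : towers) :
    Tendsto (fun k => survival (walk (launch wildWeight)) (site base) k z) atTop (𝓝 0) := by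
  -- The bound is needed to be finite only off the base, so the value ∞ there makes the inequality
  -- at the base trivial.
  refine tendsto_survival_of_supersolution _ _ (V := fun x => meanBound ∞ (site.symm x)) ?_ ?_ z
  · intro z
    obtain ⟨s, rfl⟩ := site.surjective z
    rcases s with _ | ⟨a, n⟩
    · simp [meanBound]
    · rw [Equiv.symm_apply_apply]
      exact meanBound_cell _ ∞ a n
  · intro z hz
    obtain ⟨s, rfl⟩ := site.surjective z
    rcases s with _ | ⟨a, n⟩
    · exact absurd rfl hz
    · simp [meanBound]

lemma wild_tsum_survival_eq_top :
    ∑' k, survival (walk (launch wildWeight)) (site base) k (site base) = ∞ := by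
  set κ := walk (launch wildWeight) with hκ
  set G : towers → ℝ≥0∞ := fun z => ∑' k, survival κ (site base) k z with hG
  have hGeq : ∀ z, G z = 1 + avoid κ (site base) G z := tsum_avoid_eq κ (site base) 1
  have hstep : ∀ a n, 1 + ENNReal.ofReal (climb a n) * G (site (cell a (n + 1))) ≤
      G (site (cell a n)) := by
    intro a n
    rw [hGeq (site (cell a n))]
    gcongr
    cases n with
    | zero => rw [hκ, avoid_walk_cell_zero]
    | succ n => rw [hκ, avoid_walk_cell_succ]; exact le_self_add
  -- From cell a upwards, continued climbing alone survives i steps with probability (1 − `decay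
  -- a`)^i.
  have hgeom : ∀ a m n, a ≤ n → ∑ i ∈ Finset.range m, ENNReal.ofReal (1 - decay a) ^ i ≤
      G (site (cell a n)) := by
    intro a m
    induction m with
    | zero => simp
    | succ m ih =>
      intro n hn
      refine le_trans ?_ (hstep a n)
      rw [climb, if_neg (by omega), Finset.sum_range_succ', pow_zero, add_comm]
      simp only [pow_succ', ← Finset.mul_sum]
      gcongr
      exact ih (n + 1) (by omega)
  have htop : ∀ a, (ENNReal.ofReal (decay a))⁻¹ ≤ G (site (cell a a)) := by
    intro a
    have h1 := ENNReal.tsum_le_of_sum_range_le fun m => hgeom a m a le_rfl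
    rw [ENNReal.tsum_geometric] at h1
    convert h1 using 2
    rw [← ENNReal.ofReal_one, ← ENNReal.ofReal_sub _ (by linarith [decay_le_one a])]
    simp
  -- Each of the i climbs from cell a − i to cell a succeeds with probability 1/(a+1).
  have hdown : ∀ a i : ℕ, i ≤ a → ENNReal.ofReal (1 / (a + 1)) ^ i * G (site (cell a a)) ≤
      G (site (cell a (a - i))) := by
    intro a i
    induction i with
    | zero => simp
    | succ i ih =>
      intro hi
      refine le_trans ?_ (hstep a (a - (i + 1)))
      rw [climb, if_pos (by omega), (by omega : a - (i + 1) + 1 = a - i), pow_succ', mul_assoc]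
      refine le_trans ?_ le_add_self
      gcongr
      exact ih (by omega)
  have hbottom : ∀ a, 2 ^ a ≤ G (site (cell a 0)) := by
    intro a
    have h1 := hdown a a le_rfl
    rw [Nat.sub_self] at h1
    refine le_trans ?_ ((mul_le_mul_right (htop a) _).trans h1)
    rw [← ENNReal.ofReal_pow (by positivity), ← ENNReal.ofReal_inv_of_pos (decay_pos a),
      ← ENNReal.ofReal_mul (by positivity)]
    have h2 : (1 / ((a : ℝ) + 1)) ^ a * (decay a)⁻¹ = 2 ^ a := by
      rw [decay, ← inv_pow, ← mul_pow]
      congr 1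
      field_simp
    rw [h2, ENNReal.ofReal_pow (by norm_num)]
    simp
  have hsum : ∑' a, wildWeight a * 2 ^ a ≤ G (site base) := by
    rw [hGeq, hκ, avoid_walk_launch]
    refine le_trans (ENNReal.tsum_le_tsum fun a => ?_) le_add_self
    gcongr
    exact hbottom a
  -- The weight 2^(-a-1) balances the lower bound 2^a, so every tower contributes at least 1/2 and
  -- the sum diverges.
  have hterm : ∀ a, wildWeight a * 2 ^ a = 2⁻¹ := by
    intro a
    rw [wildWeight, pow_succ', mul_assoc, ← mul_pow, ENNReal.inv_mul_cancel (by simp) (by simp),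
      one_pow, mul_one]
  simp only [hterm] at hsum
  rw [ENNReal.tsum_const_eq_top_of_ne_zero (by simp)] at hsum
  exact top_le_iff.1 hsum

/-- The sites of height less than `N`. -/
def low (N : ℕ) : Site → Prop
  | base => True
  | cell _ n => n < N

/-- A bound for the mean number of visits to the sites of height less than `N` before the next visit
to the base. -/
def visitBound (N : ℕ) : Site → ℕ
  | base => 1 + 2 * N
  | cell 0 n => min (n + 1) N
  | cell (_ + 1) n => N + (N - n)

lemma visitBound_cell_le (N a : ℕ) : visitBound N (cell a 0) ≤ 2 * N := by
  cases a <;> simp [visitBound] <;> omega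

lemma convex_combination_le (a n : ℕ) {x y z : ℝ≥0∞} (hx : x ≤ z) (hy : y ≤ z) :
    ENNReal.ofReal (climb a n) * x + ENNReal.ofReal (1 - climb a n) * y ≤ z := by
  calc _ ≤ ENNReal.ofReal (climb a n) * z + ENNReal.ofReal (1 - climb a n) * z := by gcongr
    _ = z := by rw [← add_mul, ofReal_climb_add, one_mul]

/-- An excursion passes each level at most once climbing and at most once descending through tower
0. Hence `visitBound` is a supersolution with the low indicator as source, however long the stay
above height N. -/
lemma tsum_avoid_low_ne_top (N : ℕ) :
    ∑' k, (avoid (walk (launch wildWeight)) (site base))^[k]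
      ({x | low N (site.symm x)}.indicator 1) (site base) ≠ ∞ := by
  refine ne_top_of_le_ne_top (ENNReal.natCast_ne_top (visitBound N (site.symm (site base))))
    (tsum_avoid_le _ (site base) (V := fun x => (visitBound N (site.symm x) : ℝ≥0∞)) ?_ _)
  intro z
  obtain ⟨s, rfl⟩ := site.surjective z
  rcases s with _ | ⟨a, n⟩
  · rw [avoid_walk_launch, Set.indicator_of_mem (by simp [low])]
    simp only [Equiv.symm_apply_apply, Pi.one_apply]
    calc 1 + ∑' a, wildWeight a * (visitBound N (cell a 0) : ℝ≥0∞)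
        ≤ 1 + ∑' a, wildWeight a * ((2 * N : ℕ) : ℝ≥0∞) := by
          gcongr with a
          exact visitBound_cell_le N a
      _ = (visitBound N base : ℝ≥0∞) := by
          rw [ENNReal.tsum_mul_right, tsum_wildWeight, one_mul]
          simp [visitBound]
  · have hind : {x | low N (site.symm x)}.indicator (1 : towers → ℝ≥0∞) (site (cell a n)) =
        ((if n < N then 1 else 0 : ℕ) : ℝ≥0∞) := by
      split_ifs with h
      · rw [Set.indicator_of_mem (by simpa [low] using h)]; simp
      · rw [Set.indicator_of_notMem (by simpa [low] using h)]; simp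
    suffices h : ∃ M : ℕ, avoid (walk (launch wildWeight)) (site base)
        (fun x => (visitBound N (site.symm x) : ℝ≥0∞)) (site (cell a n)) ≤ M ∧
        (if n < N then 1 else 0) + M ≤ visitBound N (cell a n) by
      obtain ⟨M, hM, hle⟩ := h
      rw [hind, Equiv.symm_apply_apply]
      refine (add_le_add_right hM _).trans ?_
      exact_mod_cast hle
    rcases n with _ | n
    · rw [avoid_walk_cell_zero]
      rcases a with _ | a
      · refine ⟨0, by simp [climb_zero], ?_⟩
        simp only [visitBound]
        split_ifs <;> omega
      · refine ⟨N + (N - 1), ?_, ?_⟩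
        · refine (mul_le_of_le_one_left zero_le
            (ENNReal.ofReal_le_one.2 (climb_lt_one _ _).le)).trans ?_
          simp [visitBound]
        · simp only [visitBound]
          split_ifs <;> omega
    · rw [avoid_walk_cell_succ]
      rcases a with _ | a
      · refine ⟨min (n + 1) N, by simp [climb_zero, visitBound], ?_⟩
        simp only [visitBound]
        split_ifs <;> omega
      -- This is the value after a climb; after a drop at most N low visits remain, which is no
      -- more.
      · refine ⟨N + (N - (n + 2)), convex_combination_le _ _ ?_ ?_, ?_⟩
        · simp [visitBound]
        · simp only [Equiv.symm_apply_apply, visitBound]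
          exact_mod_cast (by omega : min (n + 1) N ≤ N + (N - (n + 2)))
        · simp only [visitBound]
          split_ifs <;> omega

end TowerEstimates

/-! ### The setup and the failure of boundedness in probability -/

section TowerSetup

open Site

/-- The ergodic tower chain, with the adversary acting at the base only. -/
lemma exists_towerSetup : ∃ S : AdversarialSetup towers,
    S.P = walk (launch tameWeight) ∧ S.K = {site base} ∧ S.x₀ = site base ∧
      S.origin = site base ∧ S.D = 2 := by
  obtain ⟨ν, hν⟩ := exists_harrisErgodic (walk_isIrreducibleChain tameWeight_ne_zero)
    walk_tame_holding tame_tsum_survival_ne_top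
  exact ⟨{ origin := site base
           P := walk (launch tameWeight)
           markov := inferInstance
           statDist := ν
           ergodic := hν
           D := 2
           bounded_jumps := walk_dist_le _ (tsum_tameWeight_le.trans (by simp))
           K := {site base}
           K_measurable := measurableSet_singleton _
           K_bounded := Bornology.isBounded_singleton
           K_nonempty := Set.singleton_nonempty _
           x₀ := site base
           x₀_mem := rfl }, rfl, rfl, rfl, rfl, rfl⟩

lemma low_of_dist_le {N : ℕ} {x : towers} (h : dist x (site base) ≤ N) : low N (site.symm x) := by
  obtain ⟨s, rfl⟩ := site.surjective x
  rw [Equiv.symm_apply_apply]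
  rcases s with _ | ⟨a, n⟩
  · trivial
  · have h1 := (abs_ordinate_sub_le _ _).trans h
    simp only [ordinate, sub_zero] at h1
    have h2 : (n : ℝ) + 1 ≤ N := (le_abs_self _).trans h1
    exact_mod_cast h2

/-- The adversary's chain leaves every ball with probability close to one at suitable times. -/
lemma wild_not_boundedInProbability (S : AdversarialSetup towers) (hS : S.origin = site base) :
    ¬ S.BoundedInProbability (chainLaw (walk (launch wildWeight)) (site base))
      (fun n ω => ω n) := by
  intro hb
  obtain ⟨L, hL⟩ := (hb.eventually_lt_const (u := 2⁻¹) (by simp)).exists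
  rw [hS] at hL
  obtain ⟨N, hN⟩ := exists_nat_ge L
  obtain ⟨n, hn⟩ := exists_pow_apply_lt wild_tsum_survival_eq_top (tsum_avoid_low_ne_top N)
    (c := 2⁻¹) (by simp)
  have h1 := (le_iSup (fun n : ℕ => chainLaw (walk (launch wildWeight)) (site base)
    {ω | L < dist (ω n) (site base)}) n).trans_lt hL
  rw [← chainLaw_eval_apply _ _ _ .of_discrete] at hn
  -- At time n the path is either low or farther than L from the base, yet both events have
  -- probability below 1/2.
  have h2 : (1 : ℝ≥0∞) ≤ chainLaw (walk (launch wildWeight)) (site base)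
      {ω | ω n ∈ {x | low N (site.symm x)}} + chainLaw (walk (launch wildWeight)) (site base)
      {ω | L < dist (ω n) (site base)} := by
    rw [← measure_univ (μ := chainLaw (walk (launch wildWeight)) (site base))]
    refine (measure_mono fun ω _ => ?_).trans (measure_union_le _ _)
    rcases le_or_gt (dist (ω n) (site base)) L with h | h
    · exact .inl (low_of_dist_le (h.trans hN))
    · exact .inr h
  have h3 := h2.trans_lt (ENNReal.add_lt_add hn h1)
  rw [ENNReal.inv_two_add_inv_two] at h3
  exact lt_irrefl _ h3

end TowerSetup

end AdversarialMarkov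

end

/-! ### The adversarial example -/

open AdversarialMarkov

theorem proposition3 :
    ∃ (𝓧 : Set (EuclideanSpace ℝ (Fin 2))) (S : AdversarialMarkov.AdversarialSetup 𝓧)
      (Q : Kernel 𝓧 𝓧) (_ : IsMarkovKernel Q)
      (Ω : Type) (_ : MeasurableSpace Ω) (μ : Measure Ω) (X : ℕ → Ω → 𝓧),
      𝓧.Countable ∧ IsClosed 𝓧 ∧
      AdversarialMarkov.TVContinuous S.P ∧
      S.IsAdversarialChain μ X ∧
      ¬ S.BoundedInProbability μ X ∧
      -- the adversary is time-homogeneous Markov, its jumps are bounded by `D` as well,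
      -- and it turns the positive recurrent `P` into a null recurrent chain
      AdversarialMarkov.IsPositiveRecurrent S.P ∧
      (∀ x, x ∉ S.K → Q x = S.P x) ∧
      (∀ x, Q x {y | dist x y ≤ S.D} = 1) ∧
      AdversarialMarkov.IsMarkovChain Q μ X ∧
      AdversarialMarkov.IsNullRecurrent Q := by
  obtain ⟨S, hP, hK, hx, ho, hD⟩ := exists_towerSetup
  have hirrP := walk_isIrreducibleChain tameWeight_ne_zero
  have hirrQ := walk_isIrreducibleChain wildWeight_ne_zero
  have hQP : ∀ x, x ∉ S.K → walk (launch wildWeight) x = S.P x := by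
    intro x hxK
    rw [hK] at hxK
    rw [hP]
    exact walk_eq_of_ne_base _ _ hxK
  have hmarkov := isMarkovChain_chainLaw (walk (launch wildWeight)) (site .base)
  have hjump : ∀ x, walk (launch wildWeight) x {y | dist x y ≤ S.D} = 1 := by
    rw [hD]
    exact walk_dist_le _ tsum_wildWeight.le
  refine ⟨towers, S, walk (launch wildWeight), inferInstance, ℕ → towers, inferInstance,
    chainLaw (walk (launch wildWeight)) (site .base), fun n ω => ω n, countable_towers,
    isClosed_towers, ?_, ⟨inferInstance, fun n => measurable_pi_apply n, ?_, ?_, ?_⟩,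
    wild_not_boundedInProbability S ho, ?_, hQP, hjump, hmarkov, hirrQ, fun x => ⟨?_, ?_⟩⟩
  · rw [hP]
    exact walk_tvContinuous _
  · rw [hx]
    refine ae_of_ae_map (f := fun ω : ℕ → towers => ω 0) (p := fun y => y = site .base)
      (measurable_pi_apply 0).aemeasurable ?_
    rw [chainLaw_map_zero]
    exact (ae_dirac_iff .of_discrete).2 rfl
  · intro n A hA
    filter_upwards [hmarkov n A hA] with ω hω hωK
    rw [hω, hQP _ hωK]
  · intro n
    filter_upwards [chainLaw_ae_succ (walk (launch wildWeight)) (site .base) n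
      (R := fun x y => dist x y ≤ S.D) .of_discrete
      fun z => (prob_compl_eq_zero_iff .of_discrete).2 (hjump z)] with ω hω hωK
    exact ⟨ω n, hωK, hω⟩
  · have h : IsPositiveRecurrent (walk (launch tameWeight)) := ⟨hirrP, fun x => by
      rw [lintegral_returnTime]
      exact (tsum_survival_ne_top_of_irreducible hirrP tame_tsum_survival_ne_top x).lt_top⟩
    convert h
  · exact ae_returnTime_lt_top _ _ _
      (tendsto_survival_of_irreducible wild_tendsto_survival hirrQ x)
  · rw [lintegral_returnTime]
    -- A finite mean return time at one state would make it finite at the base too.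
    by_contra hc
    exact tsum_survival_ne_top_of_irreducible hirrQ hc (site .base) wild_tsum_survival_eq_top
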